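/- Let $Q=Q^{sat}(\theta,z,t):\mathbb R^3\to\mathbb R$ be smooth with $\partial_\theta Q>0$ and $\partial_zQ<0$ everywhere, and let $\Theta(w,z,t)$ be the unique solution $\theta$ of $\theta+Q(\theta,z,t)=w$. Let $n\ge 1$, $\delta t>0$, $z_j=j/n$, $J_j=[\frac{j-1}n,\frac jn)$ for $1\le j\le n$. *Discrete solution.* Initial data are numbers $\theta_1\le\dots\le\theta_n$ and $q_1,\dots,q_n$ with $q_j\le Q(\theta_j,z_j,0)$. One time step, from the values $\theta_j,q_j$ at time $k\delta t$ to the values at $\tau=(k+1)\delta t$, is as follows. Each cell holds one parcel, and the sum $\theta^M=\theta+q$ of a parcel is conserved. For $m=n,n-1,\dots,1$ successively: call the parcel in cell $j$ wet if its present $\theta$ is $<\Theta(\theta^M,z_j,\tau)$, where $\theta^M$ is its own sum, and dry otherwise; call a wet parcel, in cell $i$ and with sum $w$, eligible if each dry parcel in a cell $j$ with $i<j\le m$ has $\theta<\Theta(w,z_j,\tau)$ and each wet parcel in such a cell has $\theta^M<w$. If there are eligible parcels, the one with the largest $\theta^M$ (the highest one in case of a tie), in cell $i$ say, is moved to cell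 $m$, its $\theta$ becomes $\Theta(\theta^M,z_m,\tau)$ (and its $q$ becomes $\theta^M-\theta$), and the parcels in cells $i+1,\dots,m$ move down by one cell without any change of $\theta,q$; otherwise nothing happens. Let $\theta^n(t,z),q^n(t,z)$ be, for $z\in J_j$ and $k\delta t\le t<(k+1)\delta t$, the values in cell $j$ at time $k\delta t$. Let $F^n_t=F^n(t,\cdot)$, for the same $t$, be the composition of the maps of the first $k$ time steps, each of which translates every cell onto the cell to which its parcel is moved ($F^n_t=\mathrm{id}$ for $k=0$; put $F^n_t(1)=1$). Put $\hat\theta^n_t(z)=\hat\theta^n(t,z)=\theta^n(t,F^n_t(z))$, $\theta^n_0=\theta^n(0,\cdot)$, $q^n_0=q^n(0,\cdot)$, $\theta^{M,n}(z)=\theta_0^n(z)+q_0^n(z)$. *Theorem.* Let $T>0$ and $M'\ge0$. There are constants $C_1,C_2,C_3,C_4'>0$ that depend only on $M',T,Q$, and for every $c>0$ constants $C_4,C_5,C_6>0$ that depend only on $M',T,Q,c$, such that for all $n\ge1$, $\delta t>0$ and all initial data as above with $\|\theta^n_0\|_{L^\infty(0,1)}+\|q^n_0\|_{L^\infty(0,1)}\le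 M'$: (i) $\|\theta^n\|_{L^\infty((0,1)\times(0,T))}+\|q^n\|_{L^\infty((0,1)\times(0,T))}\le C_1$. (ii) For any $\varepsilon>C_2/n$, $t\in[0,T)$ and $z\in[0,1)$: if $\hat\theta^n(t,z)>\Theta(\theta^{M,n}(z),F^n_t(z),t)+\varepsilon$, then $\hat\theta^n_{t'}(z)=\hat\theta^n_t(z)$ and $F^n_{t'}(z)\le F^n_t(z)$ for all $t'\in[t,T)$ with $t'-t<\varepsilon/C_2$. (iii) For any $z\in[0,1]$, the total variation of $t\mapsto F^n_t(z)$ on $[0,T)$ is at most $C_3$. If moreover $c\le n\,\delta t<1/C_4'$ (for instance $\delta t=1/(Cn)$ with a fixed $C>C_4'$ and $c=1/C$), then: (iv) For any $\varepsilon>0$, any $t$ with $[t-\varepsilon,t+\varepsilon]\subset[0,T)$ and any $z\in[0,1)$, $$\Big|\hat\theta^n_{t+\varepsilon}(z)-\hat\theta^n_{t-\varepsilon}(z)-\big(\Theta(\theta^{M,n}(z),F^n_{t+\varepsilon}(z),t+\varepsilon)-\Theta(\theta^{M,n}(z),F^n_{t-\varepsilon}(z),t-\varepsilon)\big)^+\Big|\le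 2C_4(\varepsilon+\delta t).$$ (v) For any $s<t$ in $[0,T)$, $\|\theta^n(t,\cdot)-\theta^n(s,\cdot)\|_{L^1([0,1])}=\|\hat\theta^n(t,\cdot)-\hat\theta^n(s,\cdot)\|_{L^1([0,1])}\le C_5\sqrt{t-s+\delta t}$. (vi) For any $s<t$ in $[0,T)$, $\|F^n(t,\cdot)-F^n(s,\cdot)\|_{L^1([0,1])}\le C_6\sqrt{t-s+\delta t}$. -/

import Mathlib

open Set MeasureTheory
open scoped ENNReal ContDiff

namespace Rearrangement

noncomputable section

/-- Admissible saturation values `Q (θ, z, t)`: smooth on `ℝ³`, strictly increasing in the potential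
temperature `θ` and strictly decreasing in the height `z`, in the sense of strict signs of the
partial derivatives. -/
structure IsSaturation (Q : ℝ → ℝ → ℝ → ℝ) : Prop where
  smooth : ContDiff ℝ ∞ (fun p : ℝ × ℝ × ℝ => Q p.1 p.2.1 p.2.2)
  deriv_theta_pos : ∀ θ z t : ℝ, 0 < deriv (fun x => Q x z t) θ
  deriv_z_neg : ∀ θ z t : ℝ, deriv (fun y => Q θ y t) z < 0

/-- `Theta Q w z t` is the solution `θ` of `θ + Q (θ, z, t) = w` (see `existsUnique_Theta` and
`Theta_spec` for existence and uniqueness). -/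
def Theta (Q : ℝ → ℝ → ℝ → ℝ) (w z t : ℝ) : ℝ :=
  Function.invFun (fun θ => θ + Q θ z t) w

theorem existsUnique_Theta {Q : ℝ → ℝ → ℝ → ℝ} (hQ : IsSaturation Q) (w z t : ℝ) :
    ∃! θ : ℝ, θ + Q θ z t = w := by
  have hc : Continuous fun x => Q x z t :=
    hQ.smooth.continuous.comp (by fun_prop : Continuous fun x : ℝ => (x, z, t))
  have hm : StrictMono fun x => Q x z t := strictMono_of_deriv_pos fun x => hQ.deriv_theta_pos x z t
  have hs : StrictMono fun x => x + Q x z t := fun a b h => add_lt_add h (hm h)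
  obtain ⟨θ, hθ⟩ : w ∈ Set.range fun x => x + Q x z t := by
    refine mem_range_of_exists_le_of_exists_ge (continuous_id.add hc)
      ⟨min 0 (w - Q 0 z t), ?_⟩ ⟨max 0 (w - Q 0 z t), ?_⟩
    · have h1 : Q (min 0 (w - Q 0 z t)) z t ≤ Q 0 z t := hm.monotone (min_le_left _ _)
      have h2 := min_le_right 0 (w - Q 0 z t)
      change min 0 (w - Q 0 z t) + Q (min 0 (w - Q 0 z t)) z t ≤ w
      linarith
    · have h1 : Q 0 z t ≤ Q (max 0 (w - Q 0 z t)) z t := hm.monotone (le_max_left _ _)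
      have h2 := le_max_right 0 (w - Q 0 z t)
      change w ≤ max 0 (w - Q 0 z t) + Q (max 0 (w - Q 0 z t)) z t
      linarith
  exact ⟨θ, hθ, fun y hy => hs.injective (hy.trans hθ.symm)⟩

theorem Theta_spec {Q : ℝ → ℝ → ℝ → ℝ} (hQ : IsSaturation Q) (w z t : ℝ) :
    Theta Q w z t + Q (Theta Q w z t) z t = w :=
  Function.invFun_eq (f := fun θ => θ + Q θ z t) (existsUnique_Theta hQ w z t).exists

/-- The height `z_j` attached to the `j`-th cell. Indices are counted from `0`, so the cell with
index `j : Fin n` is `[j / n, (j + 1) / n)` and its height is its upper end point. -/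
def height {n : ℕ} (j : Fin n) : ℝ := ((j : ℝ) + 1) / n

/-- Values of `θ` and `q` on the cells, together with a rearrangement `β` of the indices
(`β j` is the present cell of the parcel that was in cell `j` at the start of the time step). -/
structure Parcels (n : ℕ) where
  θ : Fin n → ℝ
  q : Fin n → ℝ
  β : Equiv.Perm (Fin n)

section OneStep

variable {n : ℕ} (Q : ℝ → ℝ → ℝ → ℝ) (τ : ℝ) (θM : Fin n → ℝ)

open Classical in
/-- The wet set of a stage `P` of the time step that ends at time `τ`; `θM j` is the value of
`θ + q` of the parcel that was in cell `j` at the start of the time step. -/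
def wet (P : Parcels n) : Finset (Fin n) :=
  {j | P.θ j < Theta Q (θM (P.β.symm j)) (height j) τ}

open Classical in
/-- The wet parcels that beat all other parcels above them up to the cell `k`. -/
def eligible (k : Fin n) (P : Parcels n) : Finset (Fin n) :=
  {i ∈ wet Q τ θM P | ∀ j, i < j → j ≤ k →
    (j ∉ wet Q τ θM P → P.θ j < Theta Q (θM (P.β.symm i)) (height j) τ) ∧
    (j ∈ wet Q τ θM P → θM (P.β.symm j) < θM (P.β.symm i))}

open Classical in
/-- The eligible parcels with the largest `θ + q` among the eligible parcels. -/
def best (k : Fin n) (P : Parcels n) : Finset (Fin n) :=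
  {i ∈ eligible Q τ θM k P | ∀ j ∈ eligible Q τ θM k P,
    θM (P.β.symm j) ≤ θM (P.β.symm i)}

/-- The rearrangement which moves the parcel in cell `i ≤ k` to the cell `k`, and the parcels in the
cells `i + 1, …, k` down by one cell. -/
def lift (i k : Fin n) : Equiv.Perm (Fin n) := (Fin.cycleIcc i k).symm

open Classical in
/-- The move that decides which parcel goes to the cell `k`: the eligible parcel with the largest
`θ + q` (the highest one in case of a tie) is lifted to `k` and becomes saturated there; nothing
happens if no parcel is eligible. -/
def move (k : Fin n) (P : Parcels n) : Parcels n :=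
  if h : (best Q τ θM k P).Nonempty then
    let σ := lift ((best Q τ θM k P).max' h) k
    let β' := P.β.trans σ
    let θ' : Fin n → ℝ := fun j =>
      if j = k then Theta Q (θM (β'.symm k)) (height k) τ else P.θ (σ.symm j)
    { θ := θ'
      q := fun j => P.q (σ.symm j) + P.θ (σ.symm j) - θ' j
      β := β' }
  else P

/-- The state after the first `m` moves of the time step that starts from the cell values `θ`, `q`
and ends at time `τ`. The moves fill the cells from the top cell downwards. -/
def stage (θ q : Fin n → ℝ) : ℕ → Parcels n
  | 0 => { θ := θ, q := q, β := Equiv.refl (Fin n) }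
  | m + 1 =>
    if h : m < n then
      move Q τ (fun j => θ j + q j) (Fin.rev ⟨m, h⟩) (stage θ q m)
    else stage θ q m

end OneStep

section Evolution

variable {n : ℕ} (Q : ℝ → ℝ → ℝ → ℝ) (δt : ℝ) (θ₀ q₀ : Fin n → ℝ)

/-- The discrete solution: cell values of `θ` and `q` at time `k δt`, and the rearrangement `β` of the
time step that ends at time `k δt`. -/
def solution : ℕ → Parcels n
  | 0 => { θ := θ₀, q := q₀, β := Equiv.refl (Fin n) }
  | k + 1 => stage Q (((k : ℝ) + 1) * δt) (solution k).θ (solution k).q n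

/-- The piecewise constant function on `[0, 1)` with the value `v j` on `[j / n, (j + 1) / n)`. -/
def cellFun (v : Fin n → ℝ) (z : ℝ) : ℝ :=
  if h : ⌊(n : ℝ) * z⌋₊ < n then v ⟨⌊(n : ℝ) * z⌋₊, h⟩ else 0

/-- The map of `[0, 1)` that translates each cell `i` onto the cell `π i`; it fixes the point `1`. -/
def cellMap (π : Equiv.Perm (Fin n)) (z : ℝ) : ℝ :=
  if h : ⌊(n : ℝ) * z⌋₊ < n then
    z - height (⟨⌊(n : ℝ) * z⌋₊, h⟩ : Fin n) + height (π ⟨⌊(n : ℝ) * z⌋₊, h⟩)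
  else z

/-- The flow map from time `0` to time `k δt`. -/
def flowAt : ℕ → ℝ → ℝ
  | 0 => id
  | k + 1 => cellMap (solution Q δt θ₀ q₀ (k + 1)).β ∘ flowAt k

/-- `θⁿ (t, z)`. -/
def theta (t z : ℝ) : ℝ := cellFun (solution Q δt θ₀ q₀ ⌊t / δt⌋₊).θ z

/-- `qⁿ (t, z)`. -/
def moisture (t z : ℝ) : ℝ := cellFun (solution Q δt θ₀ q₀ ⌊t / δt⌋₊).q z

/-- The flow map `Fⁿ (t, z)`. -/
def flow (t z : ℝ) : ℝ := flowAt Q δt θ₀ q₀ ⌊t / δt⌋₊ z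

/-- `θⁿ` in Lagrangian coordinates. -/
def thetaHat (t z : ℝ) : ℝ := theta Q δt θ₀ q₀ t (flow Q δt θ₀ q₀ t z)

/-- The value of `θ + q` of the parcel that starts at `z`; it is conserved along the flow. -/
def thetaM (z : ℝ) : ℝ := cellFun θ₀ z + cellFun q₀ z

/-- Admissible discrete initial data: `θ` is increasing and `q` does not exceed its saturation value
at time `0`. -/
structure IsInitial : Prop where
  mono : Monotone θ₀
  saturation : ∀ j, q₀ j ≤ Q (θ₀ j) (height j) 0

end Evolution

/-- The `L^∞` norm on `(0, 1)` of the piecewise constant function with the cell values `v`. -/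
def supNorm {n : ℕ} (v : Fin n → ℝ) : ℝ≥0∞ := eLpNorm (cellFun v) ∞ (volume.restrict (Ioo 0 1))

end

end Rearrangement

/-! The estimates follow individual parcels. In one time step a parcel either sinks with `θ`
unchanged, or is wet and is reset to the saturation value of its new cell, which exceeds its old
`θ`. So `θ` never decreases along a parcel and never falls below saturation. This dichotomy is
`parcelTheta_succ_cases`; it rests on `StageInv`, an invariant of the single moves that also keeps
the column monotone in height.

The saturation value `Theta` is Lipschitz with constant `L` in height and time and grows with height
at a rate at least `κ`. Hence a surplus over saturation survives until height and time have changed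
enough to consume it, and a rise costs at least `κ` times its length in `θ`. As `θ` is bounded, the
total rise is bounded, hence so is the total variation of the trajectory.

A parcel may sink because many others pass it in one step. If `n δt L ≤ κ`, one cell of descent
outweighs one time step of change in saturation, so parcels that have sunk are dry. Two passings
then create an obstacle that excludes a third, and no parcel sinks more than two cells per step
(`SinkInv`, `height_le_add`). The flow permutes the cells, so the mean displacement is zero and the
bound on descent controls the mean absolute displacement. Changes of `θ` follow: a parcel whose `θ`
has changed is nearly saturated at the end of the interval, and `Theta` is Lipschitz. The resulting
`L¹` bounds are linear in `t - s + δt`; they imply those with a square root because the time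
interval is bounded. -/

namespace Rearrangement

/-! ### Monotonicity and quantitative bounds of the saturation value. -/

section ThetaEstimates

variable {Q : ℝ → ℝ → ℝ → ℝ}

theorem IsSaturation.strictMono_theta (hQ : IsSaturation Q) (z t : ℝ) :
    StrictMono fun x => Q x z t :=
  strictMono_of_deriv_pos fun x => hQ.deriv_theta_pos x z t

theorem IsSaturation.strictAnti_height (hQ : IsSaturation Q) (θ t : ℝ) :
    StrictAnti fun y => Q θ y t :=
  strictAnti_of_deriv_neg fun y => hQ.deriv_z_neg θ y t

theorem le_Theta_iff (hQ : IsSaturation Q) {x w z t : ℝ} :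
    x ≤ Theta Q w z t ↔ x + Q x z t ≤ w := by
  have hs : StrictMono fun x => x + Q x z t := strictMono_id.add (hQ.strictMono_theta z t)
  rw [← hs.le_iff_le, Theta_spec hQ]

theorem Theta_le_iff (hQ : IsSaturation Q) {x w z t : ℝ} :
    Theta Q w z t ≤ x ↔ w ≤ x + Q x z t := by
  have hs : StrictMono fun x => x + Q x z t := strictMono_id.add (hQ.strictMono_theta z t)
  rw [← hs.le_iff_le, Theta_spec hQ]

theorem lt_Theta_iff (hQ : IsSaturation Q) {x w z t : ℝ} :
    x < Theta Q w z t ↔ x + Q x z t < w := by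
  rw [← not_le, Theta_le_iff hQ, not_le]

theorem Theta_strictMono (hQ : IsSaturation Q) (z t : ℝ) :
    StrictMono fun w => Theta Q w z t := fun w w' h => by
  change Theta Q w z t < Theta Q w' z t
  rw [lt_Theta_iff hQ, Theta_spec hQ]
  exact h

theorem Theta_strictMono_height (hQ : IsSaturation Q) (w t : ℝ) :
    StrictMono fun z => Theta Q w z t := fun z z' h => by
  change Theta Q w z t < Theta Q w z' t
  rw [lt_Theta_iff hQ]
  have h1 : Q (Theta Q w z t) z' t < Q (Theta Q w z t) z t := hQ.strictAnti_height _ t h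
  linarith [Theta_spec hQ w z t]

theorem abs_Theta_le (hQ : IsSaturation Q) (w z t : ℝ) :
    |Theta Q w z t| ≤ |w| + |Q 0 z t| := by
  have h1 := abs_nonneg (Q 0 z t)
  have h2 := abs_nonneg w
  have hm := (hQ.strictMono_theta z t).monotone
  rw [abs_le]
  constructor
  · rw [le_Theta_iff hQ]
    have h3 : Q (-(|w| + |Q 0 z t|)) z t ≤ Q 0 z t := hm (by linarith)
    linarith [neg_abs_le w, le_abs_self (Q 0 z t)]
  · rw [Theta_le_iff hQ]
    have h3 : Q 0 z t ≤ Q (|w| + |Q 0 z t|) z t := hm (by linarith)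
    linarith [le_abs_self w, neg_abs_le (Q 0 z t)]

theorem exists_bound_Theta (hQ : IsSaturation Q) (W T : ℝ) :
    ∃ B > (0 : ℝ), ∀ w z t : ℝ, |w| ≤ W → z ∈ Icc (0 : ℝ) 1 → t ∈ Icc 0 T →
      |Theta Q w z t| ≤ B := by
  have hc : Continuous fun p : ℝ × ℝ => Q 0 p.1 p.2 :=
    hQ.smooth.continuous.comp (by fun_prop : Continuous fun p : ℝ × ℝ => ((0 : ℝ), p.1, p.2))
  obtain ⟨C, hC⟩ := (isCompact_Icc (a := (0 : ℝ)) (b := 1) |>.prod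
    (isCompact_Icc (a := (0 : ℝ)) (b := T))).exists_bound_of_continuousOn hc.continuousOn
  refine ⟨|W| + |C| + 1, by positivity, fun w z t hw hz ht => ?_⟩
  have h1 := abs_Theta_le hQ w z t
  have h2 : |Q 0 z t| ≤ C := hC (z, t) ⟨hz, ht⟩
  linarith [le_abs_self W, le_abs_self C]

theorem exists_lipschitz_saturation (hQ : IsSaturation Q) (B T : ℝ) :
    ∃ K > (0 : ℝ), ∀ x ∈ Icc (-B) B, ∀ x' ∈ Icc (-B) B, ∀ z ∈ Icc (0 : ℝ) 1,
      ∀ z' ∈ Icc (0 : ℝ) 1, ∀ t ∈ Icc 0 T, ∀ t' ∈ Icc 0 T,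
      |Q x z t - Q x' z' t'| ≤ K * (|x - x'| + |z - z'| + |t - t'|) := by
  have hl := ((hQ.smooth.of_le (by simp) : ContDiff ℝ 1 _).locallyLipschitz).locallyLipschitzOn
    (s := Icc (-B) B ×ˢ (Icc (0 : ℝ) 1 ×ˢ Icc 0 T))
  obtain ⟨K, hK⟩ := hl.exists_lipschitzOnWith_of_compact
    (isCompact_Icc.prod (isCompact_Icc.prod isCompact_Icc))
  refine ⟨K + 1, by positivity, fun x hx x' hx' z hz z' hz' t ht t' ht' => ?_⟩
  have h1 := hK.dist_le_mul (x, z, t) ⟨hx, hz, ht⟩ (x', z', t') ⟨hx', hz', ht'⟩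
  simp only [Prod.dist_eq, Real.dist_eq] at h1
  have h2 : max |x - x'| (max |z - z'| |t - t'|) ≤ |x - x'| + |z - z'| + |t - t'| := by
    have := abs_nonneg (x - x')
    have := abs_nonneg (z - z')
    have := abs_nonneg (t - t')
    refine max_le (by linarith) (max_le (by linarith) (by linarith))
  have h3 : 0 ≤ max |x - x'| (max |z - z'| |t - t'|) := le_max_of_le_left (abs_nonneg _)
  have h4 : (0 : ℝ) ≤ K := K.2
  nlinarith

theorem exists_saturation_height_gap (hQ : IsSaturation Q) (B T : ℝ) :
    ∃ κ > (0 : ℝ), ∀ x ∈ Icc (-B) B, ∀ t ∈ Icc 0 T, ∀ z ∈ Icc (0 : ℝ) 1, ∀ z' ∈ Icc (0 : ℝ) 1,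
      z ≤ z' → κ * (z' - z) ≤ Q x z t - Q x z' t := by
  have hd : Differentiable ℝ fun p : ℝ × ℝ × ℝ => Q p.1 p.2.1 p.2.2 :=
    hQ.smooth.differentiable (by simp)
  have hder : ∀ x z t : ℝ, HasDerivAt (fun y => Q x y t)
      (fderiv ℝ (fun p : ℝ × ℝ × ℝ => Q p.1 p.2.1 p.2.2) (x, z, t) (0, 1, 0)) z := by
    intro x z t
    have h1 : HasDerivAt (fun y : ℝ => (x, y, t)) ((0 : ℝ), (1 : ℝ), (0 : ℝ)) z :=
      (hasDerivAt_const z x).prodMk ((hasDerivAt_id z).prodMk (hasDerivAt_const z t))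
    exact (hd (x, z, t)).hasFDerivAt.comp_hasDerivAt z h1
  set D : ℝ × ℝ × ℝ → ℝ := fun p =>
    fderiv ℝ (fun p : ℝ × ℝ × ℝ => Q p.1 p.2.1 p.2.2) p (0, 1, 0) with hD
  have hDc : Continuous D := (hQ.smooth.continuous_fderiv (by simp)).clm_apply continuous_const
  -- The box is empty when `B` or `T` is negative; otherwise `-∂_z Q` attains a positive minimum on
  -- it.
  rcases (Icc (-B) B ×ˢ (Icc (0 : ℝ) 1 ×ˢ Icc 0 T)).eq_empty_or_nonempty with he | hne
  · refine ⟨1, one_pos, fun x hx t ht z hz => ?_⟩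
    have : (x, z, t) ∈ Icc (-B) B ×ˢ (Icc (0 : ℝ) 1 ×ˢ Icc 0 T) := ⟨hx, hz, ht⟩
    exact absurd this (he ▸ notMem_empty _)
  · obtain ⟨p, -, hp⟩ := (isCompact_Icc.prod (isCompact_Icc.prod isCompact_Icc)).exists_isMaxOn
      hne hDc.continuousOn
    have hneg : D p < 0 := by
      have := hQ.deriv_z_neg p.1 p.2.1 p.2.2
      rwa [(hder p.1 p.2.1 p.2.2).deriv] at this
    refine ⟨-D p, by linarith, fun x hx t ht z hz z' hz' hzz => ?_⟩
    have h1 := (convex_Icc (0 : ℝ) 1).image_sub_le_mul_sub_of_deriv_le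
      (f := fun y => Q x y t) (C := D p)
      (fun y _ => (hder x y t).continuousAt.continuousWithinAt)
      (fun y _ => (hder x y t).differentiableAt.differentiableWithinAt)
      (fun y hy => by
        rw [(hder x y t).deriv]
        exact hp (⟨hx, interior_subset hy, ht⟩ :
          (x, y, t) ∈ Icc (-B) B ×ˢ (Icc (0 : ℝ) 1 ×ˢ Icc 0 T)))
      z hz z' hz' hzz
    linarith

/-- Quantitative bounds for `Theta Q w z t` over `|w| ≤ W`, `z ∈ [0, 1]`, `t ∈ [0, T]`. -/
structure ThetaBounds (Q : ℝ → ℝ → ℝ → ℝ) (W T B L κ : ℝ) : Prop where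
  bound : ∀ w z t : ℝ, |w| ≤ W → z ∈ Icc (0 : ℝ) 1 → t ∈ Icc 0 T → |Theta Q w z t| ≤ B
  lipschitz : ∀ w z z' t t' : ℝ, |w| ≤ W → z ∈ Icc (0 : ℝ) 1 → z' ∈ Icc (0 : ℝ) 1 →
    t ∈ Icc 0 T → t' ∈ Icc 0 T →
    Theta Q w z' t' ≤ Theta Q w z t + L * (|z' - z| + |t' - t|)
  gap : ∀ w z z' t : ℝ, |w| ≤ W → z ∈ Icc (0 : ℝ) 1 → z' ∈ Icc (0 : ℝ) 1 →
    t ∈ Icc 0 T → z ≤ z' → Theta Q w z t + κ * (z' - z) ≤ Theta Q w z' t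

/-- The map `θ ↦ θ + Q` expands distances and stretches them by at most `1 + K`, where `K` is a
Lipschitz constant of `Q` on a box containing all values of `Theta`. Inverting it keeps the upper
rate `K` and divides the lower rate `κ` by `1 + K`. -/
theorem exists_thetaBounds (hQ : IsSaturation Q) (W T : ℝ) :
    ∃ B > (0 : ℝ), ∃ L > (0 : ℝ), ∃ κ > (0 : ℝ), ThetaBounds Q W T B L κ := by
  obtain ⟨B, hB, hbd⟩ := exists_bound_Theta hQ W T
  obtain ⟨K, hK, hlip⟩ := exists_lipschitz_saturation hQ B T
  obtain ⟨κ, hκ, hgap⟩ := exists_saturation_height_gap hQ B T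
  have hmem : ∀ w z t : ℝ, |w| ≤ W → z ∈ Icc (0 : ℝ) 1 → t ∈ Icc 0 T →
      Theta Q w z t ∈ Icc (-B) B := fun w z t hw hz ht => abs_le.1 (hbd w z t hw hz ht)
  refine ⟨B, hB, K, hK, κ / (1 + K), by positivity, hbd, ?_, ?_⟩
  · intro w z z' t t' hw hz hz' ht ht'
    have h0 := hmem w z t hw hz ht
    rcases le_total (Theta Q w z' t') (Theta Q w z t) with h | h
    · have := mul_nonneg hK.le (add_nonneg (abs_nonneg (z' - z)) (abs_nonneg (t' - t)))
      linarith
    · have h1 : Q (Theta Q w z t) z' t' ≤ Q (Theta Q w z' t') z' t' :=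
        (hQ.strictMono_theta z' t').monotone h
      have h2 := hlip _ h0 _ h0 z hz z' hz' t ht t' ht'
      rw [sub_self, abs_zero, zero_add, abs_sub_comm z, abs_sub_comm t] at h2
      have h3 := le_abs_self (Q (Theta Q w z t) z t - Q (Theta Q w z t) z' t')
      linarith [Theta_spec hQ w z t, Theta_spec hQ w z' t']
  · intro w z z' t hw hz hz' ht hzz
    have h0 := hmem w z t hw hz ht
    have h0' := hmem w z' t hw hz' ht
    have h : Theta Q w z t ≤ Theta Q w z' t := (Theta_strictMono_height hQ w t).monotone hzz
    have h1 := hgap _ h0 t ht z hz z' hz' hzz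
    have h2 := hlip _ h0' _ h0 z' hz' z' hz' t ht t ht
    rw [sub_self, sub_self, abs_zero, add_zero, add_zero, abs_of_nonneg (sub_nonneg.2 h)] at h2
    have h3 := le_abs_self (Q (Theta Q w z' t) z' t - Q (Theta Q w z t) z' t)
    have h4 : κ * (z' - z) ≤ (1 + K) * (Theta Q w z' t - Theta Q w z t) := by
      linarith [Theta_spec hQ w z t, Theta_spec hQ w z' t]
    have h5 : κ / (1 + K) * (z' - z) ≤ Theta Q w z' t - Theta Q w z t := by
      rw [div_mul_eq_mul_div, div_le_iff₀ (by positivity)]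
      linarith
    linarith

end ThetaEstimates

/-! ### A single move: eligibility, blocking and the effect of a lift. -/

section OneStepAnalysis

variable {n : ℕ} {Q : ℝ → ℝ → ℝ → ℝ} {τ : ℝ}

theorem height_strictMono : StrictMono (height : Fin n → ℝ) := fun i j h => by
  have hn : (0 : ℝ) < n := Nat.cast_pos.2 i.pos
  have : (i : ℝ) < j := Nat.cast_lt.2 h
  unfold height
  gcongr

theorem Theta_height_le (hQ : IsSaturation Q) {w w' : ℝ} {i j : Fin n} (hw : w ≤ w')
    (hij : i ≤ j) : Theta Q w (height i) τ ≤ Theta Q w' (height j) τ :=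
  ((Theta_strictMono hQ _ _).monotone hw).trans
    ((Theta_strictMono_height hQ _ _).monotone (height_strictMono.monotone hij))

theorem cycleIcc_val_of_ge_of_lt {i j k : Fin n} (hi : i ≤ j) (hj : j < k) :
    (Fin.cycleIcc i k j).val = j.val + 1 := by
  have : NeZero n := ⟨i.pos.ne'⟩
  rw [Fin.cycleIcc_of_ge_of_lt hi hj]
  have hk := k.isLt
  have : j.val < k.val := hj
  rw [Fin.val_add_one_of_lt' (by omega)]

theorem cycleIcc_self_right {i k : Fin n} (h : i ≤ k) : Fin.cycleIcc i k k = i :=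
  haveI : NeZero n := ⟨i.pos.ne'⟩
  Fin.cycleIcc_of_last h

variable {θM : Fin n → ℝ}

theorem mem_wet {P : Parcels n} {j : Fin n} :
    j ∈ wet Q τ θM P ↔ P.θ j < Theta Q (θM (P.β.symm j)) (height j) τ := by
  simp [wet]

theorem mem_eligible {P : Parcels n} {i k : Fin n} :
    i ∈ eligible Q τ θM k P ↔ i ∈ wet Q τ θM P ∧ ∀ j, i < j → j ≤ k →
      (j ∉ wet Q τ θM P → P.θ j < Theta Q (θM (P.β.symm i)) (height j) τ) ∧
      (j ∈ wet Q τ θM P → θM (P.β.symm j) < θM (P.β.symm i)) := by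
  simp [eligible]

/-- Merges the two clauses of eligibility: a wet parcel passed by `i` lies below its own saturation
value, hence below that of the larger sum of `i`. -/
theorem lt_Theta_of_mem_eligible (hQ : IsSaturation Q) {P : Parcels n} {i j k : Fin n}
    (h : i ∈ eligible Q τ θM k P) (hij : i ≤ j) (hjk : j ≤ k) :
    P.θ j < Theta Q (θM (P.β.symm i)) (height j) τ := by
  obtain ⟨hw, he⟩ := mem_eligible.1 h
  rcases hij.eq_or_lt with rfl | hij
  · exact mem_wet.1 hw
  · by_cases hj : j ∈ wet Q τ θM P
    · exact (mem_wet.1 hj).trans_le (Theta_height_le hQ ((he j hij hjk).2 hj).le le_rfl)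
    · exact (he j hij hjk).1 hj

theorem exists_blocking {P : Parcels n} {i k : Fin n} (hi : i ∈ wet Q τ θM P)
    (h : i ∉ eligible Q τ θM k P) : ∃ j, i < j ∧ j ≤ k ∧
      ((j ∉ wet Q τ θM P ∧ Theta Q (θM (P.β.symm i)) (height j) τ ≤ P.θ j) ∨
        (j ∈ wet Q τ θM P ∧ θM (P.β.symm i) ≤ θM (P.β.symm j))) := by
  rw [mem_eligible] at h
  push Not at h
  obtain ⟨j, h1, h2, h3⟩ := h hi
  refine ⟨j, h1, h2, ?_⟩
  by_cases hj : j ∈ wet Q τ θM P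
  · by_contra! hc
    obtain ⟨-, h4⟩ := h3 fun h => absurd hj h
    exact absurd (hc.2 hj) (not_lt.2 h4)
  · by_contra! hc
    obtain ⟨h4, -⟩ := h3 fun _ => hc.1 hj
    exact hj h4

/-- A parcel that blocks `i` but not the parcel `p` below it shows that `p` has the larger
`θ + q`. -/
theorem le_of_blocking (hQ : IsSaturation Q) {P : Parcels n} {i p j k : Fin n}
    (hp : p ∈ eligible Q τ θM k P) (hpj : p ≤ j) (hjk : j ≤ k)
    (h : (j ∉ wet Q τ θM P ∧ Theta Q (θM (P.β.symm i)) (height j) τ ≤ P.θ j) ∨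
        (j ∈ wet Q τ θM P ∧ θM (P.β.symm i) ≤ θM (P.β.symm j))) :
    θM (P.β.symm i) ≤ θM (P.β.symm p) := by
  rcases h with ⟨-, h⟩ | ⟨hj, h⟩
  · have := h.trans_lt (lt_Theta_of_mem_eligible hQ hp hpj hjk)
    exact ((Theta_strictMono hQ _ _).lt_iff_lt.1 this).le
  · rcases hpj.eq_or_lt with rfl | hpj
    · exact h
    · exact h.trans (((mem_eligible.1 hp).2 j hpj hjk).2 hj).le

/-- `P'` arises from `P` by lifting the best parcel, in cell `i`, to the cell `k`. -/
structure IsLift (Q : ℝ → ℝ → ℝ → ℝ) (τ : ℝ) (θM : Fin n → ℝ) (k i : Fin n)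
    (P P' : Parcels n) : Prop where
  mem : i ∈ eligible Q τ θM k P
  best : ∀ j ∈ eligible Q τ θM k P, θM (P.β.symm j) ≤ θM (P.β.symm i)
  source : ∀ j, P'.β.symm j = P.β.symm (Fin.cycleIcc i k j)
  -- Eligibility alone does not place `i` at or below `k`; that comes from
  -- `StageInv.le_of_mem_eligible`, since filled cells hold no wet parcel.
  theta_self : i ≤ k → P'.θ k = Theta Q (θM (P.β.symm i)) (height k) τ
  theta_ne : ∀ j, j ≠ k → P'.θ j = P.θ (Fin.cycleIcc i k j)
  sum : ∀ j, P'.q j + P'.θ j = P.q (Fin.cycleIcc i k j) + P.θ (Fin.cycleIcc i k j)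

theorem move_cases (k : Fin n) (P : Parcels n) :
    (move Q τ θM k P = P ∧ eligible Q τ θM k P = ∅) ∨
      ∃ i, IsLift Q τ θM k i P (move Q τ θM k P) := by
  by_cases h : (best Q τ θM k P).Nonempty
  · right
    set i := (best Q τ θM k P).max' h with hi
    have him : i ∈ best Q τ θM k P := Finset.max'_mem _ h
    have hb : i ∈ eligible Q τ θM k P ∧ ∀ j ∈ eligible Q τ θM k P,
        θM (P.β.symm j) ≤ θM (P.β.symm i) := by simpa [best] using him
    have hmv : move Q τ θM k P =
        { θ := fun j => if j = k then
            Theta Q (θM ((P.β.trans (lift i k)).symm k)) (height k) τ else P.θ ((lift i k).symm j)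
          q := fun j => P.q ((lift i k).symm j) + P.θ ((lift i k).symm j) - (if j = k then
            Theta Q (θM ((P.β.trans (lift i k)).symm k)) (height k) τ else P.θ ((lift i k).symm j))
          β := P.β.trans (lift i k) } := by
      unfold move
      rw [dif_pos h]
    refine ⟨i, hb.1, hb.2, fun j => ?_, fun hik => ?_, fun j hj => ?_, fun j => ?_⟩
    · rw [hmv]; rfl
    · rw [hmv]
      simp [lift, cycleIcc_self_right hik]
    · rw [hmv]
      simp [lift, hj]
    · rw [hmv]
      simp [lift]
  · left
    refine ⟨by unfold move; rw [dif_neg h], ?_⟩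
    by_contra hne
    obtain ⟨i, hi, hmax⟩ := Finset.exists_max_image (eligible Q τ θM k P)
      (fun j => θM (P.β.symm j)) (Finset.nonempty_iff_ne_empty.2 hne)
    exact h ⟨i, by simpa [best] using ⟨hi, hmax⟩⟩

namespace IsLift

variable {k i : Fin n} {P P' : Parcels n}

theorem source_of_lt (h : IsLift Q τ θM k i P P') {j : Fin n} (hj : j < i) :
    P'.β.symm j = P.β.symm j := by
  rw [h.source, Fin.cycleIcc_of_lt hj]

theorem theta_of_lt (h : IsLift Q τ θM k i P P') (hik : i ≤ k) {j : Fin n} (hj : j < i) :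
    P'.θ j = P.θ j := by
  rw [h.theta_ne j (hj.trans_le hik).ne, Fin.cycleIcc_of_lt hj]

theorem source_of_gt (h : IsLift Q τ θM k i P P') {j : Fin n} (hj : k < j) :
    P'.β.symm j = P.β.symm j := by
  rw [h.source, Fin.cycleIcc_of_gt hj]

theorem theta_of_gt (h : IsLift Q τ θM k i P P') {j : Fin n} (hj : k < j) :
    P'.θ j = P.θ j := by
  rw [h.theta_ne j hj.ne', Fin.cycleIcc_of_gt hj]

theorem source_self (h : IsLift Q τ θM k i P P') (hik : i ≤ k) :
    P'.β.symm k = P.β.symm i := by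
  rw [h.source, cycleIcc_self_right hik]

/-- Cells between `i` and `k` receive the parcel of the next higher cell. -/
theorem exists_succ (h : IsLift Q τ θM k i P P') {j : Fin n} (hij : i ≤ j) (hjk : j < k) :
    ∃ j' : Fin n, j'.val = j.val + 1 ∧ j' ≤ k ∧ P'.β.symm j = P.β.symm j' ∧ P'.θ j = P.θ j' := by
  have hv := cycleIcc_val_of_ge_of_lt hij hjk
  have hjk' : j.val < k.val := hjk
  refine ⟨Fin.cycleIcc i k j, hv, ?_, h.source j, h.theta_ne j hjk.ne⟩
  rw [Fin.le_def]
  omega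

theorem succ (h : IsLift Q τ θM k i P P') {j j' : Fin n} (hij : i ≤ j) (hjk : j < k)
    (hj : j'.val = j.val + 1) : P'.β.symm j = P.β.symm j' ∧ P'.θ j = P.θ j' := by
  obtain ⟨x, hx, -, h1⟩ := h.exists_succ hij hjk
  rwa [Fin.ext (hj.trans hx.symm)]

/-- After a lift from `i` to `k`, parcels that are eligible for a cell `m` with `i - 1 ≤ m < k` do
not have a larger `θ + q` than the lifted parcel. -/
theorem le_of_mem_eligible (hQ : IsSaturation Q) (h : IsLift Q τ θM k i P P') (hik : i ≤ k)
    {m x : Fin n} (him : i.val ≤ m.val + 1) (hmk : m < k) (hxm : x ≤ m)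
    (hx : x ∈ eligible Q τ θM m P') : θM (P'.β.symm x) ≤ θM (P.β.symm i) := by
  have hxk : x < k := hxm.trans_lt hmk
  rcases lt_or_ge x i with hxi | hxi
  · rw [h.source_of_lt hxi]
    have hwet : x ∈ wet Q τ θM P := by
      have := mem_wet.1 (mem_eligible.1 hx).1
      rw [h.source_of_lt hxi, h.theta_of_lt hik hxi] at this
      exact mem_wet.2 this
    by_cases hel : x ∈ eligible Q τ θM k P
    · exact h.best x hel
    · obtain ⟨j, hxj, hjk, hb⟩ := exists_blocking hwet hel
      rcases lt_or_ge j i with hji | hij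
      -- Cells below `i` are untouched by the lift, so this obstacle would still block `x` on its
      -- way to `m`; `him` ensures `j ≤ m`.
      · exfalso
        have hjm : j ≤ m := by
          rw [Fin.le_def]
          have : j.val < i.val := hji
          omega
        have hp := (mem_eligible.1 hx).2 j hxj hjm
        simp only [mem_wet, h.source_of_lt hji, h.source_of_lt hxi, h.theta_of_lt hik hji] at hp hb
        rcases hb with ⟨h1, h2⟩ | ⟨h1, h2⟩
        · exact absurd (hp.1 h1) (not_lt.2 h2)
        · exact absurd (hp.2 h1) (not_lt.2 h2)
      · exact le_of_blocking hQ h.mem hij hjk hb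
  · obtain ⟨j, hj, hjk, hs, hθ⟩ := h.exists_succ hxi hxk
    have hij : i < j := by
      rw [Fin.lt_def]
      have : i.val ≤ x.val := hxi
      omega
    have hw : j ∈ wet Q τ θM P := by
      have h1 := mem_wet.1 (mem_eligible.1 hx).1
      rw [hs, hθ] at h1
      refine mem_wet.2 (h1.trans_le (Theta_height_le hQ le_rfl ?_))
      rw [Fin.le_def]
      omega
    rw [hs]
    exact (((mem_eligible.1 h.mem).2 j hij hjk).2 hw).le

end IsLift

end OneStepAnalysis

/-! ### Invariants of the successive moves within one time step. -/

section StageInvariants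

variable {n : ℕ} {Q : ℝ → ℝ → ℝ → ℝ} {τ : ℝ} {θ θM : Fin n → ℝ}

/-- Effect of a time step on the parcel from cell `o` that ends in cell `j` with the value `x`:
either it has sunk without change, or it has been lifted and is saturated. -/
def Outcome (Q : ℝ → ℝ → ℝ → ℝ) (τ : ℝ) (θ θM : Fin n → ℝ) (o j : Fin n) (x : ℝ) : Prop :=
  (x = θ o ∧ j ≤ o) ∨
    (x = Theta Q (θM o) (height j) τ ∧ θ o < Theta Q (θM o) (height o) τ ∧
      θ o < Theta Q (θM o) (height j) τ)

/-- What holds after `s` moves of a time step; the cells `j` with `j + s < n` are still to be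
filled. -/
structure StageInv (Q : ℝ → ℝ → ℝ → ℝ) (τ : ℝ) (θ θM : Fin n → ℝ) (s : ℕ) (P : Parcels n) :
    Prop where
  sum : ∀ j, P.q j + P.θ j = θM (P.β.symm j)
  rest : ∀ j : Fin n, j.val + s < n → P.θ j = θ (P.β.symm j) ∧ j ≤ P.β.symm j
  filled : ∀ j : Fin n, n ≤ j.val + s →
    Theta Q (θM (P.β.symm j)) (height j) τ ≤ P.θ j ∧ Outcome Q τ θ θM (P.β.symm j) j (P.θ j)
  mono : Monotone P.θ
  -- Makes monotonicity inductive: a parcel about to be saturated in cell `k` cannot overshoot the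
  -- values already placed above.
  top : ∀ k : Fin n, k.val + s + 1 = n → ∀ i ≤ k, i ∈ eligible Q τ θM k P → ∀ j, k < j →
    Theta Q (θM (P.β.symm i)) (height k) τ ≤ P.θ j

namespace StageInv

variable {s : ℕ} {P P' : Parcels n} {k i : Fin n}

theorem le_of_mem_eligible (h : StageInv Q τ θ θM s P) (hk : k.val + s + 1 = n)
    {m : Fin n} (hi : i ∈ eligible Q τ θM m P) : i ≤ k := by
  by_contra! hc
  have h1 : k.val < i.val := hc
  have h2 := (h.filled i (by omega)).1
  exact absurd (mem_wet.1 (mem_eligible.1 hi).1) (not_lt.2 h2)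

theorem of_eligible_eq_empty (hQ : IsSaturation Q) (h : StageInv Q τ θ θM s P)
    (hk : k.val + s + 1 = n) (he : eligible Q τ θM k P = ∅) : StageInv Q τ θ θM (s + 1) P := by
  have hkw : k ∉ wet Q τ θM P := fun hw => by
    have : k ∈ eligible Q τ θM k P :=
      mem_eligible.2 ⟨hw, fun j h1 h2 => absurd h1 (not_lt.2 h2)⟩
    simp [he] at this
  refine ⟨h.sum, fun j hj => h.rest j (by omega), fun j hj => ?_, h.mono, ?_⟩
  · rcases eq_or_ne j k with rfl | hjk
    · exact ⟨not_lt.1 (mt mem_wet.2 hkw), Or.inl (h.rest j (by omega))⟩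
    · have : j.val ≠ k.val := fun hc => hjk (Fin.ext hc)
      exact h.filled j (by omega)
  · intro k' hk' i hi hel j hj
    have hkj : k ≤ j := by
      have : k'.val < j.val := hj
      rw [Fin.le_def]
      omega
    refine le_trans ?_ (h.mono hkj)
    obtain ⟨b, hib, hbk, hb⟩ := exists_blocking (k := k) (mem_eligible.1 hel).1 (by simp [he])
    -- The parcel is eligible for the cell just below `k` but not for `k`, so its obstacle sits in
    -- `k` itself, and `k` is dry.
    have hbk' : ¬ b ≤ k' := fun hbk' => by
      have := (mem_eligible.1 hel).2 b hib hbk'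
      rcases hb with ⟨h1, h2⟩ | ⟨h1, h2⟩
      · exact absurd (this.1 h1) (not_lt.2 h2)
      · exact absurd (this.2 h1) (not_lt.2 h2)
    have hbk2 : b = k := by
      rw [Fin.le_def] at hbk' hbk
      apply Fin.ext
      omega
    subst hbk2
    rcases hb with ⟨h1, h2⟩ | ⟨h1, h2⟩
    · exact (Theta_height_le hQ le_rfl (not_le.1 hbk').le).trans h2
    · exact absurd h1 hkw

theorem of_isLift (hQ : IsSaturation Q) (h : StageInv Q τ θ θM s P)
    (hk : k.val + s + 1 = n) (hl : IsLift Q τ θM k i P P') : StageInv Q τ θ θM (s + 1) P' := by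
  have hik : i ≤ k := h.le_of_mem_eligible hk hl.mem
  have hsrc : ∀ a, a < k → ∃ a', a ≤ a' ∧ a' ≤ k ∧ P'.β.symm a = P.β.symm a' ∧
      P'.θ a = P.θ a' ∧ (a < i ∧ a' = a ∨ i ≤ a ∧ a'.val = a.val + 1) := by
    intro a ha
    rcases lt_or_ge a i with hai | hai
    · exact ⟨a, le_rfl, ha.le, hl.source_of_lt hai, hl.theta_of_lt hik hai, Or.inl ⟨hai, rfl⟩⟩
    · obtain ⟨a', h1, h2, h3, h4⟩ := hl.exists_succ hai ha
      exact ⟨a', by rw [Fin.le_def]; omega, h2, h3, h4, Or.inr ⟨hai, h1⟩⟩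
  have hself : P'.θ k = Theta Q (θM (P.β.symm i)) (height k) τ := hl.theta_self hik
  have hmono : Monotone P'.θ := by
    rw [monotone_iff_forall_lt]
    intro a b hab
    rcases lt_trichotomy b k with hb | rfl | hb
    · obtain ⟨a', -, -, -, ha', hca⟩ := hsrc a (hab.trans hb)
      obtain ⟨b', -, -, -, hb', hcb⟩ := hsrc b hb
      rw [ha', hb']
      apply h.mono
      rw [Fin.le_def]
      rw [Fin.lt_def] at hab
      simp only [Fin.lt_def, Fin.le_def, Fin.ext_iff] at hca hcb
      omega
    · obtain ⟨a', -, hak, -, ha', hca⟩ := hsrc a hab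
      rw [ha', hself]
      rcases le_total a' i with hai | hai
      · exact (h.mono hai).trans ((lt_Theta_of_mem_eligible hQ hl.mem le_rfl hik).le.trans
          (Theta_height_le hQ le_rfl hik))
      · exact (lt_Theta_of_mem_eligible hQ hl.mem hai hak).le.trans
          (Theta_height_le hQ le_rfl hak)
    · rw [hl.theta_of_gt hb]
      rcases lt_trichotomy a k with ha | rfl | ha
      · obtain ⟨a', -, hak, -, ha', -⟩ := hsrc a ha
        rw [ha']
        exact h.mono (hak.trans hb.le)
      -- The only comparison of the new saturated value with cells above it; the field `top` of the
      -- previous stage supplies it.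
      · rw [hself]
        exact h.top _ hk i hik hl.mem b hb
      · rw [hl.theta_of_gt ha]
        exact h.mono hab.le
  refine ⟨fun j => by rw [hl.sum, h.sum, hl.source], fun j hj => ?_, fun j hj => ?_, hmono, ?_⟩
  · have hjk : j < k := by rw [Fin.lt_def]; omega
    obtain ⟨j', hj', hjk', hs, hθ, -⟩ := hsrc j hjk
    rw [Fin.le_def] at hjk'
    obtain ⟨h1, h2⟩ := h.rest j' (by omega)
    rw [hs, hθ]
    exact ⟨h1, hj'.trans h2⟩
  · rcases eq_or_ne j k with rfl | hjk
    · rw [hl.source_self hik, hself]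
      have hi : i.val ≤ j.val := hik
      obtain ⟨h1, h2⟩ := h.rest i (by omega)
      have h3 : P.θ i < _ := lt_Theta_of_mem_eligible hQ hl.mem le_rfl hik
      rw [h1] at h3
      exact ⟨le_rfl, Or.inr ⟨rfl, h3.trans_le (Theta_height_le hQ le_rfl h2),
        h3.trans_le (Theta_height_le hQ le_rfl hik)⟩⟩
    · have hkj : k < j := by
        have : j.val ≠ k.val := fun hc => hjk (Fin.ext hc)
        rw [Fin.lt_def]
        omega
      rw [Fin.lt_def] at hkj
      rw [hl.source_of_gt hkj, hl.theta_of_gt hkj]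
      exact h.filled j (by omega)
  · intro k' hk' x hx hel j hj
    have hkj : k ≤ j := by
      have : k'.val < j.val := hj
      rw [Fin.le_def]
      omega
    have hkk : k' < k := by rw [Fin.lt_def]; omega
    refine le_trans ?_ (hmono hkj)
    rw [hself]
    refine Theta_height_le hQ (hl.le_of_mem_eligible hQ hik ?_ hkk hx hel) hkk.le
    rw [Fin.le_def] at hik
    omega

end StageInv

theorem stageInv_zero (q : Fin n → ℝ) (hθ : Monotone θ) :
    StageInv Q τ θ (fun j => θ j + q j) 0
      { θ := θ, q := q, β := Equiv.refl (Fin n) } where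
  sum j := add_comm _ _
  rest j _ := ⟨rfl, le_rfl⟩
  filled j hj := absurd j.isLt (by omega)
  mono := hθ
  top k hk i _ _ j hj := by
    rw [Fin.lt_def] at hj
    omega

/-! ### At most two cells of descent per time step. -/

/-- What holds in addition after `s` moves if a parcel that sinks by one cell becomes dry. -/
structure SinkInv (Q : ℝ → ℝ → ℝ → ℝ) (τ : ℝ) (θM : Fin n → ℝ) (s : ℕ) (P : Parcels n) :
    Prop where
  le : ∀ j, (P.β.symm j).val ≤ j.val + 2
  -- A parcel that has already sunk two cells cannot be passed again.
  blocked : ∀ m : Fin n, m.val + s < n → ∀ j ≤ m, j.val + 2 ≤ (P.β.symm j).val →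
    ∀ x ≤ m, x ∉ eligible Q τ θM m P
  -- After one descent, lifting `x` shifts the parcel in `b` down to `b'`, where its `θ` stops every
  -- later candidate from below whose sum is at most that of `x`.
  barrier : ∀ m : Fin n, m.val + s < n → ∀ j ≤ m, j.val + 1 ≤ (P.β.symm j).val →
    ∀ x ≤ m, x ∈ eligible Q τ θM m P → ∃ b' b : Fin n, b.val = b'.val + 1 ∧ x ≤ b' ∧ b ≤ j ∧
      Theta Q (θM (P.β.symm x)) (height b') τ ≤ P.θ b

/-- A parcel that has sunk is dry: by `hdry` already one cell below its origin, and further down the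
saturation value is smaller still. -/
theorem source_eq_of_mem_wet (hQ : IsSaturation Q) {s : ℕ} {P : Parcels n}
    (hdry : ∀ b o : Fin n, o.val = b.val + 1 → Theta Q (θM o) (height b) τ ≤ θ o)
    (h : StageInv Q τ θ θM s P) {j : Fin n} (hj : j.val + s < n) (hw : j ∈ wet Q τ θM P) :
    P.β.symm j = j := by
  obtain ⟨h1, h2⟩ := h.rest j hj
  by_contra hne
  have h3 : j.val < (P.β.symm j).val := lt_of_le_of_ne h2 fun h => hne (Fin.ext h.symm)
  have h4 := mem_wet.1 hw
  have h5 := hdry ⟨(P.β.symm j).val - 1, by omega⟩ (P.β.symm j) (by simp only; omega)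
  rw [h1] at h4
  have h6 : Theta Q (θM (P.β.symm j)) (height j) τ ≤ _ :=
    (Theta_height_le hQ le_rfl (by rw [Fin.le_def]; simp only; omega)).trans h5
  exact absurd h4 (not_lt.2 h6)

/-- Later candidates start below `i` (`hlt`) and have no larger sum than the lifted parcel. A first
passing puts into cell `i` a parcel at least as warm as the lifted one was, which gives `barrier`; a
second passing shifts the barrier into place, which gives `blocked`. -/
theorem SinkInv.of_isLift (hQ : IsSaturation Q) {s : ℕ} {P P' : Parcels n} {k i : Fin n}
    (hdry : ∀ b o : Fin n, o.val = b.val + 1 → Theta Q (θM o) (height b) τ ≤ θ o)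
    (hθ : Monotone θ) (h : StageInv Q τ θ θM s P) (hS : SinkInv Q τ θM s P)
    (hk : k.val + s + 1 = n) (hl : IsLift Q τ θM k i P P') : SinkInv Q τ θM (s + 1) P' := by
  have hik : i ≤ k := h.le_of_mem_eligible hk hl.mem
  have h' := h.of_isLift hQ hk hl
  have hiv : i.val ≤ k.val := hik
  -- A wet parcel has not moved yet, so `hdry` applies to it at its own cell.
  have hi : P.β.symm i = i :=
    source_eq_of_mem_wet hQ hdry h (by omega) (mem_eligible.1 hl.mem).1
  have hlt : ∀ m x : Fin n, m < k → x ≤ m → x ∈ eligible Q τ θM m P' → x < i := by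
    intro m x hm hx hel
    by_contra! hix
    have hxk : x < k := hx.trans_lt hm
    obtain ⟨x', h1, h2, h3, -⟩ := hl.exists_succ hix hxk
    have h4 := source_eq_of_mem_wet hQ hdry h' (j := x)
      (by rw [Fin.lt_def] at hxk; omega) (mem_eligible.1 hel).1
    have h5 := (h.rest x' (by rw [Fin.le_def] at h2; omega)).2
    rw [← h3, h4, Fin.le_def] at h5
    omega
  refine ⟨fun j => ?_, fun m hm j hj hsrc x hx hel => ?_, fun m hm j hj hsrc x hx hel => ?_⟩
  · rcases lt_or_ge j i with hji | hij
    · rw [hl.source_of_lt hji]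
      exact hS.le j
    · rcases lt_trichotomy j k with hjk | rfl | hjk
      · obtain ⟨j', h1, h2, h3, -⟩ := hl.exists_succ hij hjk
        rw [h3]
        by_contra! hc
        exact hS.blocked k (by omega) j' h2 (by omega) i hik hl.mem
      · rw [hl.source_self hik, hi]
        omega
      · rw [hl.source_of_gt hjk]
        exact hS.le j
  · have hmk : m < k := by rw [Fin.lt_def]; omega
    have hxi := hlt m x hmk hx hel
    rcases lt_or_ge j i with hji | hij
    · rw [hl.source_of_lt hji] at hsrc
      exact hS.blocked k (by omega) j (hji.le.trans hik) hsrc i hik hl.mem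
    · have hjk := hj.trans_lt hmk
      obtain ⟨j', h1, h2, h3, -⟩ := hl.exists_succ hij hjk
      obtain ⟨b', b, hb, hib, hbj, hT⟩ := hS.barrier k (by omega) j' h2
        (by rw [← h3]; omega) i hik hl.mem
      simp only [Fin.le_def, Fin.lt_def] at hij hj hjk hib hbj hxi hx hmk
      have hsb := hl.succ (j := b') (j' := b) hib (by rw [Fin.lt_def]; omega) hb
      have h4 := hl.le_of_mem_eligible hQ hik (by omega) hmk hx hel
      have h5 := lt_Theta_of_mem_eligible hQ hel (j := b')
        (by rw [Fin.le_def]; omega) (by rw [Fin.le_def]; omega)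
      rw [hsb.2] at h5
      have h6 := hT.trans_lt h5
      exact absurd h6 (not_lt.2 (Theta_height_le hQ h4 le_rfl))
  · have hmk : m < k := by rw [Fin.lt_def]; omega
    have hxi := hlt m x hmk hx hel
    rcases lt_or_ge j i with hji | hij
    · rw [hl.source_of_lt hji] at hsrc
      obtain ⟨b', b, hb, hib, hbj, -⟩ := hS.barrier k (by omega) j (hji.le.trans hik) hsrc i hik
        hl.mem
      simp only [Fin.le_def, Fin.lt_def] at hji hib hbj
      omega
    · have hjk := hj.trans_lt hmk
      obtain ⟨i', h1, h2, h3, h4⟩ := hl.exists_succ le_rfl (hij.trans_lt hjk)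
      simp only [Fin.le_def, Fin.lt_def] at hij hj hjk hxi hx hmk h2
      have hw := hl.le_of_mem_eligible hQ hik (by omega) hmk hx hel
      -- The barrier is the parcel that has just dropped into cell `i`; since `x < i`, the cell `i -
      -- 1` exists.
      refine ⟨⟨i.val - 1, by omega⟩, i, by simp only; omega, by rw [Fin.le_def]; simp only; omega,
        hij, ?_⟩
      obtain ⟨h5, h6⟩ := h.rest i' (by omega)
      have h7 := hdry ⟨i.val - 1, by omega⟩ i (by simp only; omega)
      rw [h4, h5]
      rw [hi] at hw
      refine ((Theta_height_le hQ hw le_rfl).trans h7).trans (hθ ?_)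
      rw [Fin.le_def] at h6 ⊢
      omega

theorem stageInv_stage (hQ : IsSaturation Q) (q : Fin n → ℝ) (hθ : Monotone θ) (s : ℕ)
    (hs : s ≤ n) : StageInv Q τ θ (fun j => θ j + q j) s (stage Q τ θ q s) := by
  induction s with
  | zero => exact stageInv_zero q hθ
  | succ s ih =>
    have hsn : s < n := hs
    have hk : (Fin.rev (⟨s, hsn⟩ : Fin n)).val + s + 1 = n := by
      rw [Fin.val_rev]; simp only; omega
    rw [stage, dif_pos hsn]
    rcases move_cases (Q := Q) (τ := τ) (θM := fun j => θ j + q j) (Fin.rev ⟨s, hsn⟩)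
      (stage Q τ θ q s) with ⟨h1, h2⟩ | ⟨i, hi⟩
    · rw [h1]
      exact (ih hsn.le).of_eligible_eq_empty hQ hk h2
    · exact (ih hsn.le).of_isLift hQ hk hi

theorem sinkInv_stage (hQ : IsSaturation Q) (q : Fin n → ℝ) (hθ : Monotone θ)
    (hdry : ∀ b o : Fin n, o.val = b.val + 1 → Theta Q (θ o + q o) (height b) τ ≤ θ o) (s : ℕ)
    (hs : s ≤ n) : SinkInv Q τ (fun j => θ j + q j) s (stage Q τ θ q s) := by
  induction s with
  | zero =>
    refine ⟨fun j => ?_, fun m _ j _ h => ?_, fun m _ j _ h => ?_⟩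
    · change j.val ≤ j.val + 2
      omega
    · change j.val + 2 ≤ j.val at h
      omega
    · change j.val + 1 ≤ j.val at h
      omega
  | succ s ih =>
    have hsn : s < n := hs
    have hk : (Fin.rev (⟨s, hsn⟩ : Fin n)).val + s + 1 = n := by
      rw [Fin.val_rev]; simp only; omega
    have hst := stageInv_stage (τ := τ) hQ q hθ s hsn.le
    rw [stage, dif_pos hsn]
    rcases move_cases (Q := Q) (τ := τ) (θM := fun j => θ j + q j) (Fin.rev ⟨s, hsn⟩)
      (stage Q τ θ q s) with ⟨h1, h2⟩ | ⟨i, hi⟩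
    · rw [h1]
      have h3 := ih hsn.le
      exact ⟨h3.le, fun m hm => h3.blocked m (by omega), fun m hm => h3.barrier m (by omega)⟩
    · exact (ih hsn.le).of_isLift hQ hdry hθ hst hk hi

end StageInvariants

/-! ### Parcels followed over many time steps. -/

section Trajectories

variable {n : ℕ} {Q : ℝ → ℝ → ℝ → ℝ} {δt : ℝ} {θ₀ q₀ : Fin n → ℝ}

/-- The rearrangement of the cells from time `0` to time `k δt`. -/
noncomputable def flowPerm (Q : ℝ → ℝ → ℝ → ℝ) (δt : ℝ) (θ₀ q₀ : Fin n → ℝ) : ℕ → Equiv.Perm (Fin n)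
  | 0 => Equiv.refl (Fin n)
  | k + 1 => (flowPerm Q δt θ₀ q₀ k).trans (solution Q δt θ₀ q₀ (k + 1)).β

/-- The value of `θ` at time `k δt` of the parcel that starts in cell `i`. -/
noncomputable def parcelTheta (Q : ℝ → ℝ → ℝ → ℝ) (δt : ℝ) (θ₀ q₀ : Fin n → ℝ) (k : ℕ)
    (i : Fin n) : ℝ :=
  (solution Q δt θ₀ q₀ k).θ (flowPerm Q δt θ₀ q₀ k i)

theorem monotone_solution (hQ : IsSaturation Q) (hI : IsInitial Q θ₀ q₀) (k : ℕ) :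
    Monotone (solution Q δt θ₀ q₀ k).θ := by
  induction k with
  | zero => exact hI.mono
  | succ k ih => exact (stageInv_stage hQ _ ih n le_rfl).mono

theorem stageInv_solution (hQ : IsSaturation Q) (hI : IsInitial Q θ₀ q₀) (k : ℕ) :
    StageInv Q (((k : ℝ) + 1) * δt) (solution Q δt θ₀ q₀ k).θ
      (fun j => (solution Q δt θ₀ q₀ k).θ j + (solution Q δt θ₀ q₀ k).q j) n
      (solution Q δt θ₀ q₀ (k + 1)) :=
  stageInv_stage hQ _ (monotone_solution hQ hI k) n le_rfl

theorem sum_flowPerm (hQ : IsSaturation Q) (hI : IsInitial Q θ₀ q₀) (k : ℕ) (i : Fin n) :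
    (solution Q δt θ₀ q₀ k).θ (flowPerm Q δt θ₀ q₀ k i) +
      (solution Q δt θ₀ q₀ k).q (flowPerm Q δt θ₀ q₀ k i) = θ₀ i + q₀ i := by
  induction k with
  | zero => rfl
  | succ k ih =>
    rw [← ih, add_comm, (stageInv_solution hQ hI k).sum]
    simp [flowPerm]

theorem Theta_le_parcelTheta (hQ : IsSaturation Q) (hI : IsInitial Q θ₀ q₀) (k : ℕ) (i : Fin n) :
    Theta Q (θ₀ i + q₀ i) (height (flowPerm Q δt θ₀ q₀ k i)) (k * δt) ≤
      parcelTheta Q δt θ₀ q₀ k i := by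
  rw [← sum_flowPerm hQ hI k i]
  cases k with
  | zero =>
    rw [Nat.cast_zero, zero_mul, Theta_le_iff hQ]
    exact add_le_add le_rfl (hI.saturation i)
  | succ k =>
    have h := stageInv_solution (δt := δt) hQ hI k
    have h1 := (h.filled (flowPerm Q δt θ₀ q₀ (k + 1) i) (Nat.le_add_left _ _)).1
    rw [← h.sum] at h1
    rw [add_comm (Parcels.θ _ _), Nat.cast_succ]
    exact h1

theorem parcelTheta_succ_cases (hQ : IsSaturation Q) (hI : IsInitial Q θ₀ q₀) (k : ℕ)
    (i : Fin n) :
    (parcelTheta Q δt θ₀ q₀ (k + 1) i = parcelTheta Q δt θ₀ q₀ k i ∧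
      flowPerm Q δt θ₀ q₀ (k + 1) i ≤ flowPerm Q δt θ₀ q₀ k i) ∨
    (parcelTheta Q δt θ₀ q₀ (k + 1) i =
        Theta Q (θ₀ i + q₀ i) (height (flowPerm Q δt θ₀ q₀ (k + 1) i)) ((k + 1) * δt) ∧
      parcelTheta Q δt θ₀ q₀ k i <
        Theta Q (θ₀ i + q₀ i) (height (flowPerm Q δt θ₀ q₀ k i)) ((k + 1) * δt) ∧
      parcelTheta Q δt θ₀ q₀ k i <
        Theta Q (θ₀ i + q₀ i) (height (flowPerm Q δt θ₀ q₀ (k + 1) i)) ((k + 1) * δt)) := by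
  have h := ((stageInv_solution (δt := δt) hQ hI k).filled (flowPerm Q δt θ₀ q₀ (k + 1) i)
    (Nat.le_add_left _ _)).2
  have hs : (solution Q δt θ₀ q₀ (k + 1)).β.symm (flowPerm Q δt θ₀ q₀ (k + 1) i) =
      flowPerm Q δt θ₀ q₀ k i := by
    simp [flowPerm]
  rw [hs, Outcome, sum_flowPerm hQ hI] at h
  exact h

theorem parcelTheta_mono (hQ : IsSaturation Q) (hI : IsInitial Q θ₀ q₀) (i : Fin n) :
    Monotone fun k => parcelTheta Q δt θ₀ q₀ k i := by
  refine monotone_nat_of_le_succ fun k => ?_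
  rcases parcelTheta_succ_cases (δt := δt) hQ hI k i with ⟨h, -⟩ | ⟨h, -, h'⟩
  · exact h.ge
  · exact h ▸ h'.le

theorem height_mem_Icc (j : Fin n) : height j ∈ Icc (0 : ℝ) 1 := by
  have hn : (0 : ℝ) < n := Nat.cast_pos.2 j.pos
  have : (j : ℝ) + 1 ≤ n := by exact_mod_cast j.isLt
  exact ⟨by unfold height; positivity, (div_le_one hn).2 this⟩

theorem time_mem_Icc (hδ : 0 < δt) {T : ℝ} {k l : ℕ} (hkl : k ≤ l) (hl : (l : ℝ) * δt ≤ T) :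
    (k : ℝ) * δt ∈ Icc 0 T :=
  ⟨by positivity, le_trans (by gcongr) hl⟩

variable {W T B L κ : ℝ}

theorem abs_parcelTheta_le (hQ : IsSaturation Q) (hI : IsInitial Q θ₀ q₀)
    (hb : ThetaBounds Q W T B L κ) (hδ : 0 < δt) (i : Fin n) (hw : |θ₀ i + q₀ i| ≤ W)
    {k : ℕ} (hk : (k : ℝ) * δt ≤ T) :
    |parcelTheta Q δt θ₀ q₀ k i| ≤ max |θ₀ i| B := by
  induction k with
  | zero => exact le_max_left _ _
  | succ k ih =>
    rcases parcelTheta_succ_cases (δt := δt) hQ hI k i with ⟨h, -⟩ | ⟨h, -⟩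
    · rw [h]
      exact ih (time_mem_Icc hδ k.le_succ hk).2
    · rw [h, ← Nat.cast_succ]
      exact le_max_of_le_right (hb.bound _ _ _ hw (height_mem_Icc _) (time_mem_Icc hδ le_rfl hk))

/-- The increments of the height of a parcel are controlled by those of a bounded quantity. -/
theorem abs_height_sub_le (hQ : IsSaturation Q) (hI : IsInitial Q θ₀ q₀)
    (hb : ThetaBounds Q W T B L κ) (hκ : 0 < κ) (hδ : 0 < δt) (i : Fin n)
    (hw : |θ₀ i + q₀ i| ≤ W) {k l : ℕ} (hkl : k ≤ l) (hl : (l : ℝ) * δt ≤ T) :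
    |height (flowPerm Q δt θ₀ q₀ l i) - height (flowPerm Q δt θ₀ q₀ k i)| ≤
      (height (flowPerm Q δt θ₀ q₀ k i) - height (flowPerm Q δt θ₀ q₀ l i)) +
        2 / κ * (parcelTheta Q δt θ₀ q₀ l i - parcelTheta Q δt θ₀ q₀ k i) := by
  induction l, hkl using Nat.le_induction with
  | base => simp
  -- A descent contributes only to the height term. A rise has absolute value `2` times itself minus
  -- itself, and `κ` times the rise is paid for by the gain of `θ`.
  | succ l hkl ih =>
    have h1 := ih (time_mem_Icc hδ l.le_succ hl).2
    refine (abs_sub_le _ (height (flowPerm Q δt θ₀ q₀ l i)) _).trans ?_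
    suffices h : |height (flowPerm Q δt θ₀ q₀ (l + 1) i) - height (flowPerm Q δt θ₀ q₀ l i)| ≤
        (height (flowPerm Q δt θ₀ q₀ l i) - height (flowPerm Q δt θ₀ q₀ (l + 1) i)) +
          2 / κ * (parcelTheta Q δt θ₀ q₀ (l + 1) i - parcelTheta Q δt θ₀ q₀ l i) by
      linarith
    have hm : parcelTheta Q δt θ₀ q₀ l i ≤ parcelTheta Q δt θ₀ q₀ (l + 1) i :=
      parcelTheta_mono hQ hI i l.le_succ
    have hd : 0 ≤ 2 / κ * (parcelTheta Q δt θ₀ q₀ (l + 1) i - parcelTheta Q δt θ₀ q₀ l i) :=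
      mul_nonneg (by positivity) (sub_nonneg.2 hm)
    rcases le_total (flowPerm Q δt θ₀ q₀ (l + 1) i) (flowPerm Q δt θ₀ q₀ l i) with hx | hx
    · have := height_strictMono.monotone hx
      rw [abs_of_nonpos (by linarith)]
      linarith
    · have hx' := height_strictMono.monotone hx
      rw [abs_of_nonneg (by linarith)]
      have h3 : κ * (height (flowPerm Q δt θ₀ q₀ (l + 1) i) -
          height (flowPerm Q δt θ₀ q₀ l i)) ≤
          parcelTheta Q δt θ₀ q₀ (l + 1) i - parcelTheta Q δt θ₀ q₀ l i := by
        rcases parcelTheta_succ_cases (δt := δt) hQ hI l i with ⟨h, h'⟩ | ⟨h, h', -⟩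
        · rw [le_antisymm hx h', sub_self, mul_zero]
          linarith
        · have := hb.gap (θ₀ i + q₀ i) _ _ ((l + 1 : ℝ) * δt) hw
            (height_mem_Icc (flowPerm Q δt θ₀ q₀ l i))
            (height_mem_Icc (flowPerm Q δt θ₀ q₀ (l + 1) i))
            (by rw [← Nat.cast_succ]; exact time_mem_Icc hδ le_rfl hl) hx'
          linarith
      have h4 : height (flowPerm Q δt θ₀ q₀ (l + 1) i) - height (flowPerm Q δt θ₀ q₀ l i) ≤
          1 / κ * (parcelTheta Q δt θ₀ q₀ (l + 1) i - parcelTheta Q δt θ₀ q₀ l i) := by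
        rw [one_div_mul_eq_div, le_div_iff₀ hκ]
        linarith
      have h5 : 2 / κ * (parcelTheta Q δt θ₀ q₀ (l + 1) i - parcelTheta Q δt θ₀ q₀ l i) =
        2 * (1 / κ * (parcelTheta Q δt θ₀ q₀ (l + 1) i - parcelTheta Q δt θ₀ q₀ l i)) := by ring
      linarith

/-- A parcel with a surplus of `θ` over its saturation value keeps its value and does not rise as
long as the surplus exceeds the possible change of the saturation value. -/
theorem parcelTheta_eq_of_surplus (hQ : IsSaturation Q) (hI : IsInitial Q θ₀ q₀)
    (hb : ThetaBounds Q W T B L κ) (hL : 0 < L) (hδ : 0 < δt) (i : Fin n)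
    (hw : |θ₀ i + q₀ i| ≤ W) {k l : ℕ} (hkl : k ≤ l) (hl : (l : ℝ) * δt ≤ T) {a t' t : ℝ}
    (ht : 0 ≤ t) (htT : t ≤ T) (htk : t < (k + 1) * δt) (hlt : l * δt ≤ t')
    (ha : a ∈ Icc (0 : ℝ) 1)
    (h : Theta Q (θ₀ i + q₀ i) a t +
      L * (|height (flowPerm Q δt θ₀ q₀ k i) - a| + (t' - t)) ≤ parcelTheta Q δt θ₀ q₀ k i) :
    parcelTheta Q δt θ₀ q₀ l i = parcelTheta Q δt θ₀ q₀ k i ∧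
      flowPerm Q δt θ₀ q₀ l i ≤ flowPerm Q δt θ₀ q₀ k i := by
  induction l, hkl using Nat.le_induction with
  | base => exact ⟨rfl, le_rfl⟩
  | succ l hkl ih =>
    have hl' : (l : ℝ) * δt ≤ (l + 1 : ℕ) * δt := by gcongr; omega
    obtain ⟨h1, h2⟩ := ih (hl'.trans hl) (hl'.trans hlt)
    rcases parcelTheta_succ_cases (δt := δt) hQ hI l i with ⟨h3, h4⟩ | ⟨-, h3, -⟩
    · exact ⟨h3.trans h1, h4.trans h2⟩
    · exfalso
      have hkl' : ((k : ℝ) + 1) * δt ≤ (l + 1 : ℕ) * δt := by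
        push_cast
        gcongr
      -- A lift needs the parcel to be wet at time `(l + 1) δt`. It has not risen since step `k`, so
      -- the saturation value at its height of step `k` bounds the current one, and the surplus is
      -- larger than the possible change.
      have h4 := hb.lipschitz _ a (height (flowPerm Q δt θ₀ q₀ k i)) t ((l + 1 : ℕ) * δt) hw ha
        (height_mem_Icc _) ⟨ht, htT⟩ (time_mem_Icc hδ le_rfl hl)
      rw [abs_of_nonneg (by linarith : 0 ≤ ((l + 1 : ℕ) : ℝ) * δt - t)] at h4
      have h5 : L * (|height (flowPerm Q δt θ₀ q₀ k i) - a| + ((l + 1 : ℕ) * δt - t)) ≤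
          L * (|height (flowPerm Q δt θ₀ q₀ k i) - a| + (t' - t)) := by gcongr
      have h6 := Theta_height_le (τ := (l + 1 : ℕ) * δt) hQ (le_refl (θ₀ i + q₀ i)) h2
      rw [h1] at h3
      push_cast at h3 h4 h5 h6
      linarith

theorem height_le_add (hQ : IsSaturation Q) (hI : IsInitial Q θ₀ q₀)
    (hb : ThetaBounds Q W T B L κ) (hδ : 0 < δt) (hw : ∀ i, |θ₀ i + q₀ i| ≤ W)
    (hsmall : n * δt * L ≤ κ) (i : Fin n) {k l : ℕ} (hkl : k ≤ l) (hl : (l : ℝ) * δt ≤ T) :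
    height (flowPerm Q δt θ₀ q₀ k i) ≤
      height (flowPerm Q δt θ₀ q₀ l i) + 2 / n * ((l : ℝ) - k) := by
  have hn : (0 : ℝ) < n := Nat.cast_pos.2 i.pos
  induction l, hkl using Nat.le_induction with
  | base => simp
  | succ l hkl ih =>
    have hlT := time_mem_Icc hδ l.le_succ hl
    have hl1 := time_mem_Icc hδ le_rfl hl
    have h1 := ih hlT.2
    -- One cell of descent lowers the saturation value by at least `κ / n`, one time step raises it
    -- by at most `L δt`; `hsmall` says that the first wins.
    have hdry : ∀ b o : Fin n, o.val = b.val + 1 →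
        Theta Q ((solution Q δt θ₀ q₀ l).θ o + (solution Q δt θ₀ q₀ l).q o) (height b)
          (((l : ℝ) + 1) * δt) ≤ (solution Q δt θ₀ q₀ l).θ o := by
      intro b o hbo
      obtain ⟨x, rfl⟩ := (flowPerm Q δt θ₀ q₀ l).surjective o
      rw [sum_flowPerm hQ hI]
      have h2 := Theta_le_parcelTheta (δt := δt) hQ hI l x
      have hho : height (flowPerm Q δt θ₀ q₀ l x) = height b + 1 / n := by
        unfold height
        rw [hbo]
        push_cast
        ring
      have h3 := hb.gap (θ₀ x + q₀ x) (height b) (height (flowPerm Q δt θ₀ q₀ l x)) _ (hw x)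
        (height_mem_Icc _) (height_mem_Icc _) hl1 (by
          rw [hho]
          have : (0 : ℝ) ≤ 1 / n := by positivity
          linarith)
      have h4 := hb.lipschitz (θ₀ x + q₀ x) (height (flowPerm Q δt θ₀ q₀ l x))
        (height (flowPerm Q δt θ₀ q₀ l x)) (l * δt) _ (hw x)
        (height_mem_Icc _) (height_mem_Icc _) hlT hl1
      have h5 : ((l + 1 : ℕ) : ℝ) * δt - l * δt = δt := by push_cast; ring
      rw [h5, abs_of_pos hδ, sub_self, abs_zero, zero_add] at h4
      have h6 : L * δt ≤ κ * (1 / n) := by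
        rw [mul_one_div, le_div_iff₀ hn]
        linarith
      have h7 : height (flowPerm Q δt θ₀ q₀ l x) - height b = 1 / n := by rw [hho]; ring
      rw [h7] at h3
      rw [Nat.cast_succ] at h3 h4
      unfold parcelTheta at h2
      linarith
    have h2 := (sinkInv_stage hQ (solution Q δt θ₀ q₀ l).q (monotone_solution hQ hI l) hdry n
      le_rfl).le (flowPerm Q δt θ₀ q₀ (l + 1) i)
    have h3 : (stage Q (((l : ℝ) + 1) * δt) (solution Q δt θ₀ q₀ l).θ
        (solution Q δt θ₀ q₀ l).q n).β.symm (flowPerm Q δt θ₀ q₀ (l + 1) i) =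
        flowPerm Q δt θ₀ q₀ l i := by
      simp [flowPerm, solution]
    rw [h3] at h2
    have h4 : height (flowPerm Q δt θ₀ q₀ l i) ≤
        height (flowPerm Q δt θ₀ q₀ (l + 1) i) + 2 / n := by
      have h5 : ((flowPerm Q δt θ₀ q₀ l i).val : ℝ) ≤
          (flowPerm Q δt θ₀ q₀ (l + 1) i).val + 2 := by exact_mod_cast h2
      unfold height
      rw [← add_div]
      exact div_le_div_of_nonneg_right (by linarith) hn.le
    push_cast
    linarith

/-- Between two times, a parcel has either sunk without change, or it was saturated, up to a small
error, at both times. -/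
theorem parcelTheta_cases (hQ : IsSaturation Q) (hI : IsInitial Q θ₀ q₀)
    (hb : ThetaBounds Q W T B L κ) (hL : 0 < L) (hδ : 0 < δt) (hw : ∀ i, |θ₀ i + q₀ i| ≤ W)
    (hsmall : n * δt * L ≤ κ) (i : Fin n) {k l : ℕ} (hkl : k ≤ l) (hl : (l : ℝ) * δt ≤ T) :
    (parcelTheta Q δt θ₀ q₀ l i = parcelTheta Q δt θ₀ q₀ k i ∧
      flowPerm Q δt θ₀ q₀ l i ≤ flowPerm Q δt θ₀ q₀ k i) ∨
    (parcelTheta Q δt θ₀ q₀ k i ≤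
        Theta Q (θ₀ i + q₀ i) (height (flowPerm Q δt θ₀ q₀ k i)) (k * δt) +
          L * δt * ((l : ℝ) - k) ∧
      parcelTheta Q δt θ₀ q₀ l i ≤
        Theta Q (θ₀ i + q₀ i) (height (flowPerm Q δt θ₀ q₀ l i)) (l * δt) +
          L * (2 / n + δt) * ((l : ℝ) - k)) := by
  have hn : (0 : ℝ) < n := Nat.cast_pos.2 i.pos
  induction l, hkl using Nat.le_induction with
  | base => exact Or.inl ⟨rfl, le_rfl⟩
  | succ l hkl ih =>
    have hlT := time_mem_Icc hδ l.le_succ hl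
    have hl1 := time_mem_Icc hδ le_rfl hl
    have hkT := time_mem_Icc hδ (hkl.trans l.le_succ) hl
    have hkl' : (k : ℝ) ≤ l := by exact_mod_cast hkl
    have h1 := ih hlT.2
    have h5 : ((l + 1 : ℕ) : ℝ) * δt - l * δt = δt := by push_cast; ring
    rcases parcelTheta_succ_cases (δt := δt) hQ hI l i with ⟨h3, h4⟩ | ⟨h3, h4, -⟩
    · rcases h1 with ⟨h1, h2⟩ | ⟨h1, h2⟩
      · exact Or.inl ⟨h3.trans h1, h4.trans h2⟩
      -- After a lift, each step without one lowers the height by at most `2 / n`, so the excess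
      -- over saturation grows by at most `L (2 / n + δt)`.
      · refine Or.inr ⟨h1.trans ?_, ?_⟩
        · gcongr
          exact l.le_succ
        · rw [h3]
          have h6 := hb.lipschitz (θ₀ i + q₀ i) (height (flowPerm Q δt θ₀ q₀ (l + 1) i))
            (height (flowPerm Q δt θ₀ q₀ l i)) ((l + 1 : ℕ) * δt) (l * δt) (hw i)
            (height_mem_Icc _) (height_mem_Icc _) hl1 hlT
          rw [abs_sub_comm (_ * δt), h5, abs_of_pos hδ] at h6
          have h7 := height_le_add hQ hI hb hδ hw hsmall i l.le_succ hl
          have h8 := height_strictMono.monotone h4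
          have h10 : ((l.succ : ℕ) : ℝ) - l = 1 := by push_cast; ring
          rw [h10, mul_one, Nat.succ_eq_add_one] at h7
          rw [abs_of_nonneg (by linarith)] at h6
          have h9 : L * (height (flowPerm Q δt θ₀ q₀ l i) -
              height (flowPerm Q δt θ₀ q₀ (l + 1) i) + δt) ≤ L * (2 / n + δt) := by
            gcongr
            linarith
          have h11 : L * (2 / n + δt) * (((l + 1 : ℕ) : ℝ) - k) =
              L * (2 / n + δt) * ((l : ℝ) - k) + L * (2 / n + δt) := by push_cast; ring
          linarith
    · refine Or.inr ⟨?_, ?_⟩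
      · rcases h1 with ⟨h1, h2⟩ | ⟨h1, -⟩
        -- First lift: the parcel was wet just before it and had only sunk since step `k`, so it was
        -- almost saturated at step `k`.
        · rw [← h1]
          have h6 := hb.lipschitz (θ₀ i + q₀ i) (height (flowPerm Q δt θ₀ q₀ k i))
            (height (flowPerm Q δt θ₀ q₀ k i)) (k * δt) ((l + 1 : ℕ) * δt) (hw i)
            (height_mem_Icc _) (height_mem_Icc _) hkT hl1
          have h7 := Theta_height_le (τ := (l + 1 : ℕ) * δt) hQ (le_refl (θ₀ i + q₀ i)) h2
          have h8 : ((l + 1 : ℕ) : ℝ) * δt - k * δt = δt * (((l + 1 : ℕ) : ℝ) - k) := by ring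
          have h9 : 0 ≤ δt * (((l + 1 : ℕ) : ℝ) - k) := by
            refine mul_nonneg hδ.le ?_
            push_cast
            linarith
          rw [sub_self, abs_zero, zero_add, h8, abs_of_nonneg h9, ← mul_assoc] at h6
          rw [Nat.cast_succ] at h6 h7 ⊢
          linarith
        · refine h1.trans ?_
          gcongr
          exact l.le_succ
      · rw [h3, Nat.cast_succ]
        have : 0 ≤ L * (2 / n + δt) * ((l : ℝ) + 1 - k) :=
          mul_nonneg (by positivity) (by linarith)
        linarith

/-- The displacements of a permutation of the cells sum to zero, and each is at least `-d` with `d =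
2 (l - k) / n`. Hence `|x| ≤ x + 2 d`, and summation removes `x`. -/
theorem sum_abs_height_sub_le (hQ : IsSaturation Q) (hI : IsInitial Q θ₀ q₀)
    (hb : ThetaBounds Q W T B L κ) (hδ : 0 < δt) (hw : ∀ i, |θ₀ i + q₀ i| ≤ W)
    (hsmall : n * δt * L ≤ κ) {k l : ℕ} (hkl : k ≤ l) (hl : (l : ℝ) * δt ≤ T) :
    ∑ i, |height (flowPerm Q δt θ₀ q₀ l i) - height (flowPerm Q δt θ₀ q₀ k i)| ≤
      n * (4 / n * ((l : ℝ) - k)) := by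
  have hkl' : (k : ℝ) ≤ l := by exact_mod_cast hkl
  have h0 : ∑ i, (height (flowPerm Q δt θ₀ q₀ l i) - height (flowPerm Q δt θ₀ q₀ k i)) = 0 := by
    rw [Finset.sum_sub_distrib, Equiv.sum_comp _ height, Equiv.sum_comp _ height, sub_self]
  have h1 : ∑ i, |height (flowPerm Q δt θ₀ q₀ l i) - height (flowPerm Q δt θ₀ q₀ k i)| ≤
      ∑ i, ((height (flowPerm Q δt θ₀ q₀ l i) - height (flowPerm Q δt θ₀ q₀ k i)) +
        4 / n * ((l : ℝ) - k)) := by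
    refine Finset.sum_le_sum fun i _ => ?_
    have h2 := height_le_add hQ hI hb hδ hw hsmall i hkl hl
    have h3 : (4 : ℝ) / n * ((l : ℝ) - k) = 2 * (2 / n * ((l : ℝ) - k)) := by ring
    have h4 : (0 : ℝ) ≤ 2 / n * ((l : ℝ) - k) := mul_nonneg (by positivity) (by linarith)
    rw [abs_le]
    constructor <;> linarith
  rwa [Finset.sum_add_distrib, h0, zero_add, Finset.sum_const, Finset.card_univ, Fintype.card_fin,
    nsmul_eq_mul] at h1

/-- A parcel whose `θ` changes is above saturation at the start and nearly saturated at the end, so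
the change is at most `L` times its displacement plus small errors; `6 = 4 + 2` adds the two
contributions in `1 / n`. -/
theorem sum_parcelTheta_sub_le (hQ : IsSaturation Q) (hI : IsInitial Q θ₀ q₀)
    (hb : ThetaBounds Q W T B L κ) (hL : 0 < L) (hδ : 0 < δt) (hw : ∀ i, |θ₀ i + q₀ i| ≤ W)
    (hsmall : n * δt * L ≤ κ) {k l : ℕ} (hkl : k ≤ l) (hl : (l : ℝ) * δt ≤ T) :
    ∑ i, (parcelTheta Q δt θ₀ q₀ l i - parcelTheta Q δt θ₀ q₀ k i) ≤
      n * (L * (6 / n + 2 * δt) * ((l : ℝ) - k)) := by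
  have hkl' : (k : ℝ) ≤ l := by exact_mod_cast hkl
  have h1 : ∑ i, (parcelTheta Q δt θ₀ q₀ l i - parcelTheta Q δt θ₀ q₀ k i) ≤
      ∑ i, (L * |height (flowPerm Q δt θ₀ q₀ l i) - height (flowPerm Q δt θ₀ q₀ k i)| +
        L * (2 / n + 2 * δt) * ((l : ℝ) - k)) := by
    refine Finset.sum_le_sum fun i _ => ?_
    have h0 : 0 ≤ L * (2 / n + 2 * δt) * ((l : ℝ) - k) :=
      mul_nonneg (by positivity) (by linarith)
    have h0' := mul_nonneg hL.le
      (abs_nonneg (height (flowPerm Q δt θ₀ q₀ l i) - height (flowPerm Q δt θ₀ q₀ k i)))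
    rcases parcelTheta_cases hQ hI hb hL hδ hw hsmall i hkl hl with ⟨h2, -⟩ | ⟨-, h2⟩
    · rw [h2, sub_self]
      linarith
    · have h3 := Theta_le_parcelTheta (δt := δt) hQ hI k i
      have h4 := hb.lipschitz (θ₀ i + q₀ i) (height (flowPerm Q δt θ₀ q₀ k i))
        (height (flowPerm Q δt θ₀ q₀ l i)) (k * δt) (l * δt) (hw i)
        (height_mem_Icc _) (height_mem_Icc _) (time_mem_Icc hδ hkl hl) (time_mem_Icc hδ le_rfl hl)
      rw [abs_of_nonneg (by rw [← sub_mul]; exact mul_nonneg (by linarith) hδ.le :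
        0 ≤ (l : ℝ) * δt - k * δt)] at h4
      have h5 : L * (2 / n + δt) * ((l : ℝ) - k) + L * ((l : ℝ) * δt - k * δt) =
        L * (2 / n + 2 * δt) * ((l : ℝ) - k) := by ring
      linarith
  refine h1.trans ?_
  rw [Finset.sum_add_distrib, ← Finset.mul_sum, Finset.sum_const, Finset.card_univ,
    Fintype.card_fin, nsmul_eq_mul]
  have h2 := mul_le_mul_of_nonneg_left (sum_abs_height_sub_le hQ hI hb hδ hw hsmall hkl hl) hL.le
  have h3 : L * (n * (4 / n * ((l : ℝ) - k))) + n * (L * (2 / n + 2 * δt) * ((l : ℝ) - k)) =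
    n * (L * (6 / n + 2 * δt) * ((l : ℝ) - k)) := by ring
  linarith

/-- Monotone rearrangement preserves order. -/
theorem le_of_monotone_of_perm {a b : Fin n → ℝ} (ha : Monotone a) (hb : Monotone b)
    (π : Equiv.Perm (Fin n)) (h : ∀ i, a i ≤ b (π i)) (j : Fin n) : a j ≤ b j := by
  -- Pigeonhole: `π` cannot map the indices `≥ j` injectively into those `> j`.
  obtain ⟨i, hi, hij⟩ : ∃ i ∈ Finset.Ici j, π i ≤ j := by
    by_contra! hc
    have h1 : (Finset.Ici j).card ≤ (Finset.Ioi j).card :=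
      Finset.card_le_card_of_injOn π (fun i hi => by simpa using hc i hi) π.injective.injOn
    rw [Fin.card_Ici, Fin.card_Ioi] at h1
    omega
  exact (ha (Finset.mem_Ici.1 hi)).trans ((h i).trans (hb hij))

theorem solution_theta_le (hQ : IsSaturation Q) (hI : IsInitial Q θ₀ q₀) {k l : ℕ} (hkl : k ≤ l)
    (j : Fin n) : (solution Q δt θ₀ q₀ k).θ j ≤ (solution Q δt θ₀ q₀ l).θ j := by
  refine le_of_monotone_of_perm (monotone_solution hQ hI k) (monotone_solution hQ hI l)
    ((flowPerm Q δt θ₀ q₀ k).symm.trans (flowPerm Q δt θ₀ q₀ l)) (fun i => ?_) j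
  have h := parcelTheta_mono (δt := δt) hQ hI ((flowPerm Q δt θ₀ q₀ k).symm i) hkl
  simpa [parcelTheta] using h

/-- Both the cell values and the parcel values only increase in time, so the absolute values drop
and the sums differ by a permutation. -/
theorem sum_abs_solution_theta_sub (hQ : IsSaturation Q) (hI : IsInitial Q θ₀ q₀) {k l : ℕ}
    (hkl : k ≤ l) :
    ∑ j, |(solution Q δt θ₀ q₀ l).θ j - (solution Q δt θ₀ q₀ k).θ j| =
      ∑ i, |parcelTheta Q δt θ₀ q₀ l i - parcelTheta Q δt θ₀ q₀ k i| := by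
  rw [Finset.sum_congr rfl fun j _ => abs_of_nonneg (sub_nonneg.2 (solution_theta_le hQ hI hkl j)),
    Finset.sum_congr rfl fun i _ => abs_of_nonneg (sub_nonneg.2 (parcelTheta_mono hQ hI i hkl)),
    Finset.sum_sub_distrib, Finset.sum_sub_distrib]
  unfold parcelTheta
  rw [Equiv.sum_comp _ (solution Q δt θ₀ q₀ l).θ, Equiv.sum_comp _ (solution Q δt θ₀ q₀ k).θ]

end Trajectories

/-! ### Passage from cell values to functions on the unit interval. -/

section Cells

variable {n : ℕ}

theorem floor_eq_iff_mem_cell {z : ℝ} (hz : 0 ≤ z) (i : Fin n) :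
    ⌊(n : ℝ) * z⌋₊ = i.val ↔ z ∈ Ico ((i : ℝ) / n) (((i : ℝ) + 1) / n) := by
  have hn : (0 : ℝ) < n := Nat.cast_pos.2 i.pos
  rw [Nat.floor_eq_iff (by positivity), mem_Ico, div_le_iff₀ hn, lt_div_iff₀ hn, mul_comm z]

theorem exists_cell (hn : 0 < n) {z : ℝ} (hz : z ∈ Ico (0 : ℝ) 1) :
    ∃ i : Fin n, ⌊(n : ℝ) * z⌋₊ = i.val := by
  have hn' : (0 : ℝ) < n := Nat.cast_pos.2 hn
  refine ⟨⟨⌊(n : ℝ) * z⌋₊, ?_⟩, rfl⟩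
  rw [Nat.floor_lt (mul_nonneg hn'.le hz.1)]
  nlinarith [hz.2]

theorem cellFun_eq {z : ℝ} {i : Fin n} (h : ⌊(n : ℝ) * z⌋₊ = i.val) (v : Fin n → ℝ) :
    cellFun v z = v i := by
  unfold cellFun
  rw [dif_pos (h ▸ i.isLt)]
  congr 1
  exact Fin.ext h

theorem cellMap_eq {z : ℝ} {i : Fin n} (h : ⌊(n : ℝ) * z⌋₊ = i.val) (π : Equiv.Perm (Fin n)) :
    cellMap π z = z - height i + height (π i) := by
  unfold cellMap
  rw [dif_pos (h ▸ i.isLt)]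
  have : (⟨⌊(n : ℝ) * z⌋₊, h ▸ i.isLt⟩ : Fin n) = i := Fin.ext h
  rw [this]

theorem floor_shift {z : ℝ} {i : Fin n} (hz : 0 ≤ z) (h : ⌊(n : ℝ) * z⌋₊ = i.val) (x : Fin n) :
    0 ≤ z - height i + height x ∧ ⌊(n : ℝ) * (z - height i + height x)⌋₊ = x.val := by
  have hn : (0 : ℝ) < n := Nat.cast_pos.2 i.pos
  obtain ⟨h1, h2⟩ := (Nat.floor_eq_iff (by positivity)).1 h
  have h3 : (n : ℝ) * (z - height i + height x) = n * z - i + x := by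
    unfold height
    field_simp
    ring
  have hx : (0 : ℝ) ≤ x := by positivity
  have h4 : 0 ≤ (n : ℝ) * (z - height i + height x) := by rw [h3]; linarith
  refine ⟨nonneg_of_mul_nonneg_right h4 hn, ?_⟩
  rw [Nat.floor_eq_iff h4, h3]
  constructor <;> linarith

theorem sub_height_mem {z : ℝ} {i : Fin n} (hz : 0 ≤ z) (h : ⌊(n : ℝ) * z⌋₊ = i.val) :
    -(1 / (n : ℝ)) ≤ z - height i ∧ z - height i < 0 := by
  obtain ⟨h1, h2⟩ := (floor_eq_iff_mem_cell hz i).1 h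
  unfold height
  rw [add_div] at h2 ⊢
  constructor <;> linarith

theorem flowAt_eq {Q : ℝ → ℝ → ℝ → ℝ} {δt : ℝ} {θ₀ q₀ : Fin n → ℝ} {z : ℝ} {i : Fin n}
    (hz : 0 ≤ z) (h : ⌊(n : ℝ) * z⌋₊ = i.val) (k : ℕ) :
    flowAt Q δt θ₀ q₀ k z = z - height i + height (flowPerm Q δt θ₀ q₀ k i) := by
  induction k with
  | zero => simp [flowAt, flowPerm]
  | succ k ih =>
    have h1 := (floor_shift hz h (flowPerm Q δt θ₀ q₀ k i)).2
    rw [flowAt, Function.comp_apply, ih, cellMap_eq h1, flowPerm, Equiv.trans_apply]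
    ring

theorem flowAt_one {Q : ℝ → ℝ → ℝ → ℝ} {δt : ℝ} {θ₀ q₀ : Fin n → ℝ} (k : ℕ) :
    flowAt Q δt θ₀ q₀ k 1 = 1 := by
  induction k with
  | zero => rfl
  | succ k ih =>
    rw [flowAt, Function.comp_apply, ih, cellMap, dif_neg (by simp)]

theorem cellFun_flowAt_eq {Q : ℝ → ℝ → ℝ → ℝ} {δt : ℝ} {θ₀ q₀ : Fin n → ℝ} {z : ℝ} {i : Fin n}
    (hz : 0 ≤ z) (h : ⌊(n : ℝ) * z⌋₊ = i.val) (k : ℕ) :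
    cellFun (solution Q δt θ₀ q₀ k).θ (flowAt Q δt θ₀ q₀ k z) = parcelTheta Q δt θ₀ q₀ k i := by
  rw [flowAt_eq hz h, cellFun_eq (floor_shift hz h _).2, parcelTheta]

theorem eLpNorm_one_of_cells (hn : 0 < n) {f : ℝ → ℝ} (v : Fin n → ℝ)
    (hf : ∀ z ∈ Ico (0 : ℝ) 1, ∀ i : Fin n, ⌊(n : ℝ) * z⌋₊ = i.val → f z = v i) :
    eLpNorm f 1 (volume.restrict (Icc 0 1)) = ENNReal.ofReal (1 / n * ∑ i, |v i|) := by
  have hn' : (0 : ℝ) < n := Nat.cast_pos.2 hn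
  have hsub : ∀ i : Fin n, Ico ((i : ℝ) / n) (((i : ℝ) + 1) / n) ⊆ Ico (0 : ℝ) 1 := by
    intro i z hz
    have : (i : ℝ) + 1 ≤ n := by exact_mod_cast i.isLt
    exact ⟨le_trans (by positivity) hz.1, hz.2.trans_le ((div_le_one hn').2 this)⟩
  have hU : Ico (0 : ℝ) 1 = ⋃ i : Fin n, Ico ((i : ℝ) / n) (((i : ℝ) + 1) / n) := by
    refine Subset.antisymm (fun z hz => ?_) (iUnion_subset hsub)
    obtain ⟨i, hi⟩ := exists_cell hn hz
    exact mem_iUnion.2 ⟨i, (floor_eq_iff_mem_cell hz.1 i).1 hi⟩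
  have hd : Pairwise (Function.onFun Disjoint
      fun i : Fin n => Ico ((i : ℝ) / n) (((i : ℝ) + 1) / n)) := by
    intro i j hij
    refine disjoint_left.2 fun z hzi hzj => hij (Fin.ext ?_)
    have h0 := (hsub i hzi).1
    rw [← (floor_eq_iff_mem_cell h0 i).2 hzi, ← (floor_eq_iff_mem_cell h0 j).2 hzj]
  rw [eLpNorm_one_eq_lintegral_enorm, ← restrict_Ico_eq_restrict_Icc, hU,
    lintegral_iUnion (fun i => measurableSet_Ico) hd, tsum_fintype, Finset.mul_sum,
    ENNReal.ofReal_sum_of_nonneg fun i _ => by positivity]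
  refine Finset.sum_congr rfl fun i _ => ?_
  have hc : ∀ z ∈ Ico ((i : ℝ) / n) (((i : ℝ) + 1) / n), ‖f z‖ₑ = ‖v i‖ₑ := fun z hz => by
    rw [hf z (hsub i hz) i ((floor_eq_iff_mem_cell (hsub i hz).1 i).2 hz)]
  rw [setLIntegral_congr_fun measurableSet_Ico hc, setLIntegral_const, Real.volume_Ico,
    Real.enorm_eq_ofReal_abs, ← ENNReal.ofReal_mul (abs_nonneg _)]
  congr 1
  ring

theorem abs_le_of_supNorm_le {v : Fin n → ℝ} {M : ℝ} (hM : 0 ≤ M)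
    (h : supNorm v ≤ ENNReal.ofReal M) (i : Fin n) : |v i| ≤ M := by
  have hn' : (0 : ℝ) < n := Nat.cast_pos.2 i.pos
  by_contra! hc
  have h1 : ∀ᵐ z ∂(volume.restrict (Ioo (0 : ℝ) 1)), ‖cellFun v z‖ₑ ≤ ENNReal.ofReal M := by
    rw [supNorm, eLpNorm_exponent_top] at h
    filter_upwards [ae_le_eLpNormEssSup (f := cellFun v)
      (μ := volume.restrict (Ioo (0 : ℝ) 1))] with z hz
    exact hz.trans h
  rw [ae_restrict_iff' measurableSet_Ioo, ae_iff] at h1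
  have h2 : Ioo ((i : ℝ) / n) (((i : ℝ) + 1) / n) ⊆
      {z | ¬(z ∈ Ioo (0 : ℝ) 1 → ‖cellFun v z‖ₑ ≤ ENNReal.ofReal M)} := by
    intro z hz
    have h3 : (i : ℝ) + 1 ≤ n := by exact_mod_cast i.isLt
    have h4 : 0 < z := lt_of_le_of_lt (by positivity) hz.1
    have h5 : z < 1 := hz.2.trans_le ((div_le_one hn').2 h3)
    have h6 := cellFun_eq ((floor_eq_iff_mem_cell h4.le i).2 ⟨hz.1.le, hz.2⟩) v
    simp only [mem_ofPred_eq, Classical.not_imp, not_le]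
    refine ⟨⟨h4, h5⟩, ?_⟩
    rw [h6, Real.enorm_eq_ofReal_abs]
    exact (ENNReal.ofReal_lt_ofReal_iff (hM.trans_lt hc)).2 hc
  -- An almost everywhere bound reaches every cell value because each cell has positive measure.
  have h3 := measure_mono_null h2 h1
  rw [Real.volume_Ioo, ENNReal.ofReal_eq_zero, ← sub_div, add_sub_cancel_left] at h3
  exact absurd h3 (not_le.2 (by positivity))

theorem eLpNorm_top_restrict_le {α : Type*} [MeasurableSpace α] {μ : Measure α} {s : Set α}
    (hs : MeasurableSet s) {f : α → ℝ} {C : ℝ} (h : ∀ x ∈ s, |f x| ≤ C) :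
    eLpNorm f ∞ (μ.restrict s) ≤ ENNReal.ofReal C := by
  rw [eLpNorm_exponent_top]
  exact eLpNormEssSup_le_of_ae_bound ((ae_restrict_iff' hs).2 (.of_forall h))

theorem eVariationOn_le_of_dominated {f G : ℝ → ℝ} {s : Set ℝ} {C : ℝ}
    (h : ∀ x ∈ s, ∀ y ∈ s, x ≤ y → |f y - f x| ≤ G y - G x)
    (hC : ∀ x ∈ s, ∀ y ∈ s, G y - G x ≤ C) : eVariationOn f s ≤ ENNReal.ofReal C := by
  refine iSup_le fun p => ?_
  obtain ⟨N, u, hu, hus⟩ := p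
  have h1 : ∀ i ∈ Finset.range N, edist (f (u (i + 1))) (f (u i)) ≤
      ENNReal.ofReal (G (u (i + 1)) - G (u i)) := fun i _ => by
    rw [edist_dist, Real.dist_eq]
    exact ENNReal.ofReal_le_ofReal (h _ (hus i) _ (hus (i + 1)) (hu i.le_succ))
  refine (Finset.sum_le_sum h1).trans ?_
  rw [← ENNReal.ofReal_sum_of_nonneg fun i _ =>
    (abs_nonneg _).trans (h _ (hus i) _ (hus (i + 1)) (hu i.le_succ)),
    Finset.sum_range_sub fun i => G (u i)]
  exact ENNReal.ofReal_le_ofReal (hC _ (hus 0) _ (hus N))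

end Cells

/-! ### Passage from step numbers to real times. -/

section TimeSteps

variable {δt : ℝ}

theorem floor_mul_le (hδ : 0 < δt) {t : ℝ} (ht : 0 ≤ t) : (⌊t / δt⌋₊ : ℝ) * δt ≤ t :=
  (le_div_iff₀ hδ).1 (Nat.floor_le (by positivity))

theorem lt_floor_mul (hδ : 0 < δt) (t : ℝ) : t < ((⌊t / δt⌋₊ : ℝ) + 1) * δt :=
  (div_lt_iff₀ hδ).1 (Nat.lt_floor_add_one _)

theorem floor_div_mono (hδ : 0 < δt) {s t : ℝ} (hst : s ≤ t) : ⌊s / δt⌋₊ ≤ ⌊t / δt⌋₊ :=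
  Nat.floor_mono (by gcongr)

theorem floor_sub_mul_le (hδ : 0 < δt) {s t : ℝ} (ht : 0 ≤ t) :
    δt * ((⌊t / δt⌋₊ : ℝ) - ⌊s / δt⌋₊) ≤ t - s + δt := by
  linarith [floor_mul_le hδ ht, lt_floor_mul hδ s]

end TimeSteps

/-! ### The estimates in terms of `flow`, `theta` and `thetaHat`. -/

section Estimates

variable {n : ℕ} {Q : ℝ → ℝ → ℝ → ℝ} {δt : ℝ} {θ₀ q₀ : Fin n → ℝ} {M T B L κ : ℝ}

theorem flow_mem_Icc (hn : 0 < n) {z : ℝ} (hz : z ∈ Ico (0 : ℝ) 1) (t : ℝ) :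
    flow Q δt θ₀ q₀ t z ∈ Icc (0 : ℝ) 1 := by
  obtain ⟨i, hi⟩ := exists_cell hn hz
  rw [flow, flowAt_eq hz.1 hi]
  refine ⟨(floor_shift hz.1 hi _).1, ?_⟩
  linarith [(sub_height_mem hz.1 hi).2, (height_mem_Icc (flowPerm Q δt θ₀ q₀ ⌊t / δt⌋₊ i)).2]

theorem abs_height_sub_flow_le {z : ℝ} {i : Fin n} (hz : 0 ≤ z) (hi : ⌊(n : ℝ) * z⌋₊ = i.val)
    (t : ℝ) : |height (flowPerm Q δt θ₀ q₀ ⌊t / δt⌋₊ i) - flow Q δt θ₀ q₀ t z| ≤ 1 / n := by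
  rw [flow, flowAt_eq hz hi, abs_le]
  obtain ⟨h1, h2⟩ := sub_height_mem hz hi
  constructor <;> linarith [(by positivity : (0 : ℝ) ≤ 1 / n)]

theorem thetaM_eq {z : ℝ} {i : Fin n} (hi : ⌊(n : ℝ) * z⌋₊ = i.val) :
    thetaM θ₀ q₀ z = θ₀ i + q₀ i := by
  rw [thetaM, cellFun_eq hi, cellFun_eq hi]

theorem thetaHat_eq {z : ℝ} {i : Fin n} (hz : 0 ≤ z) (hi : ⌊(n : ℝ) * z⌋₊ = i.val) (t : ℝ) :
    thetaHat Q δt θ₀ q₀ t z = parcelTheta Q δt θ₀ q₀ ⌊t / δt⌋₊ i :=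
  cellFun_flowAt_eq hz hi _

theorem eLpNorm_theta_add_moisture_le (hQ : IsSaturation Q) (hI : IsInitial Q θ₀ q₀)
    (hb : ThetaBounds Q (2 * M) T B L κ) (hB : 0 < B) (hM : 0 ≤ M) (hn : 0 < n) (hδ : 0 < δt)
    (hθ : ∀ i, |θ₀ i| ≤ M) (hw : ∀ i, |θ₀ i + q₀ i| ≤ 2 * M) :
    eLpNorm (fun p : ℝ × ℝ => theta Q δt θ₀ q₀ p.1 p.2) ∞ (volume.restrict (Ioo 0 T ×ˢ Ioo 0 1)) +
      eLpNorm (fun p : ℝ × ℝ => moisture Q δt θ₀ q₀ p.1 p.2) ∞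
        (volume.restrict (Ioo 0 T ×ˢ Ioo 0 1)) ≤
      ENNReal.ofReal ((M + B) + (3 * M + B)) := by
  have hmeas : MeasurableSet (Ioo 0 T ×ˢ Ioo (0 : ℝ) 1) := measurableSet_Ioo.prod measurableSet_Ioo
  have key : ∀ p ∈ Ioo 0 T ×ˢ Ioo (0 : ℝ) 1, ∃ (j i : Fin n),
      theta Q δt θ₀ q₀ p.1 p.2 = (solution Q δt θ₀ q₀ ⌊p.1 / δt⌋₊).θ j ∧
      moisture Q δt θ₀ q₀ p.1 p.2 = (solution Q δt θ₀ q₀ ⌊p.1 / δt⌋₊).q j ∧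
      |(solution Q δt θ₀ q₀ ⌊p.1 / δt⌋₊).θ j| ≤ M + B ∧
      (solution Q δt θ₀ q₀ ⌊p.1 / δt⌋₊).θ j + (solution Q δt θ₀ q₀ ⌊p.1 / δt⌋₊).q j =
        θ₀ i + q₀ i := by
    rintro ⟨t, z⟩ ⟨ht, hz⟩
    obtain ⟨j, hj⟩ := exists_cell hn ⟨hz.1.le, hz.2⟩
    obtain ⟨i, rfl⟩ := (flowPerm Q δt θ₀ q₀ ⌊t / δt⌋₊).surjective j
    refine ⟨_, i, cellFun_eq hj _, cellFun_eq hj _, ?_, sum_flowPerm hQ hI _ i⟩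
    refine (abs_parcelTheta_le hQ hI hb hδ i (hw i)
      ((floor_mul_le hδ ht.1.le).trans ht.2.le)).trans (max_le ?_ ?_)
    · linarith [hθ i]
    · linarith
  rw [ENNReal.ofReal_add (by linarith) (by linarith)]
  refine add_le_add (eLpNorm_top_restrict_le hmeas fun p hp => ?_)
    (eLpNorm_top_restrict_le hmeas fun p hp => ?_)
  · obtain ⟨j, i, h1, -, h2, -⟩ := key p hp
    rw [h1]
    exact h2
  · obtain ⟨j, i, -, h1, h2, h3⟩ := key p hp
    rw [h1, eq_sub_of_add_eq' h3]
    refine (abs_sub _ _).trans ?_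
    linarith [hw i]

theorem thetaHat_eq_of_surplus (hQ : IsSaturation Q) (hI : IsInitial Q θ₀ q₀)
    (hb : ThetaBounds Q (2 * M) T B L κ) (hL : 0 < L) (hn : 0 < n) (hδ : 0 < δt)
    (hw : ∀ i, |θ₀ i + q₀ i| ≤ 2 * M) {ε t z : ℝ} (hε : 2 * L / n < ε) (ht : t ∈ Ico 0 T)
    (hz : z ∈ Ico (0 : ℝ) 1)
    (h : Theta Q (thetaM θ₀ q₀ z) (flow Q δt θ₀ q₀ t z) t + ε < thetaHat Q δt θ₀ q₀ t z)
    {t' : ℝ} (htt : t ≤ t') (htT : t' < T) (hclose : t' - t < ε / (2 * L)) :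
    thetaHat Q δt θ₀ q₀ t' z = thetaHat Q δt θ₀ q₀ t z ∧
      flow Q δt θ₀ q₀ t' z ≤ flow Q δt θ₀ q₀ t z := by
  obtain ⟨i, hi⟩ := exists_cell hn hz
  have hF := abs_height_sub_flow_le (Q := Q) (δt := δt) (θ₀ := θ₀) (q₀ := q₀) hz.1 hi t
  rw [thetaHat_eq hz.1 hi, thetaM_eq hi] at h
  rw [thetaHat_eq hz.1 hi, thetaHat_eq hz.1 hi]
  -- Half of `ε` absorbs the distance between `flow` and the top of its cell, the other half the
  -- change of time; hence the constant `2 L`.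
  have h1 : L * (1 / n) < ε / 2 := by
    have : L * (1 / n) = 2 * L / n / 2 := by ring
    linarith
  have h2 : L * (t' - t) < ε / 2 := by
    rw [lt_div_iff₀ (by positivity)] at hclose
    linarith
  have h3 := mul_le_mul_of_nonneg_left hF hL.le
  obtain ⟨h4, h5⟩ := parcelTheta_eq_of_surplus hQ hI hb hL hδ i (hw i) (floor_div_mono hδ htt)
    ((floor_mul_le hδ (ht.1.trans htt)).trans htT.le) ht.1 ht.2.le (lt_floor_mul hδ t)
    (floor_mul_le hδ (ht.1.trans htt)) (flow_mem_Icc hn hz t) (by rw [mul_add]; linarith)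
  refine ⟨h4, ?_⟩
  rw [flow, flow, flowAt_eq hz.1 hi, flowAt_eq hz.1 hi]
  linarith [height_strictMono.monotone h5]

theorem eVariationOn_flow_le (hQ : IsSaturation Q) (hI : IsInitial Q θ₀ q₀)
    (hb : ThetaBounds Q (2 * M) T B L κ) (hB : 0 < B) (hκ : 0 < κ) (hM : 0 ≤ M) (hn : 0 < n)
    (hδ : 0 < δt) (hθ : ∀ i, |θ₀ i| ≤ M) (hw : ∀ i, |θ₀ i + q₀ i| ≤ 2 * M) {z : ℝ}
    (hz : z ∈ Icc (0 : ℝ) 1) :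
    eVariationOn (fun t => flow Q δt θ₀ q₀ t z) (Ico 0 T) ≤
      ENNReal.ofReal (1 + 2 / κ * (2 * (M + B))) := by
  rcases hz.2.eq_or_lt with rfl | hz1
  · refine eVariationOn_le_of_dominated (G := 0) (fun s _ t _ _ => ?_) (fun s _ t _ => ?_)
    · simp only [flow, flowAt_one]
      simp
    · simp only [Pi.zero_apply, sub_self]
      positivity
  · obtain ⟨i, hi⟩ := exists_cell hn ⟨hz.1, hz1⟩
    refine eVariationOn_le_of_dominated
      (G := fun t => 2 / κ * parcelTheta Q δt θ₀ q₀ ⌊t / δt⌋₊ i -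
        height (flowPerm Q δt θ₀ q₀ ⌊t / δt⌋₊ i)) (fun s hs t ht hst => ?_) (fun s hs t ht => ?_)
    · have h := abs_height_sub_le hQ hI hb hκ hδ i (hw i) (floor_div_mono hδ hst)
        ((floor_mul_le hδ ht.1).trans ht.2.le)
      simp only [flow, flowAt_eq hz.1 hi, add_sub_add_left_eq_sub]
      linarith
    · have hbd : ∀ t ∈ Ico 0 T, |parcelTheta Q δt θ₀ q₀ ⌊t / δt⌋₊ i| ≤ M + B := fun t ht =>
        (abs_parcelTheta_le hQ hI hb hδ i (hw i) ((floor_mul_le hδ ht.1).trans ht.2.le)).trans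
          (max_le (by linarith [hθ i]) (by linarith))
      have h1 := (abs_le.1 (hbd s hs)).1
      have h2 := (abs_le.1 (hbd t ht)).2
      have h3 : 2 / κ * (parcelTheta Q δt θ₀ q₀ ⌊t / δt⌋₊ i -
          parcelTheta Q δt θ₀ q₀ ⌊s / δt⌋₊ i) ≤ 2 / κ * (2 * (M + B)) := by
        gcongr
        linarith
      have h4 := (height_mem_Icc (flowPerm Q δt θ₀ q₀ ⌊t / δt⌋₊ i)).1
      have h5 := (height_mem_Icc (flowPerm Q δt θ₀ q₀ ⌊s / δt⌋₊ i)).2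
      linarith

theorem one_div_le_of_le_mul {c : ℝ} (hc : 0 < c) (hn : 0 < n) (h : c ≤ n * δt) :
    1 / (n : ℝ) ≤ δt / c := by
  have hn' : (0 : ℝ) < n := Nat.cast_pos.2 hn
  rw [div_le_div_iff₀ hn' hc]
  linarith

/-- If the parcel only sank, its `θ` is unchanged and the saturation value can have grown only
through time. Otherwise it is nearly saturated at both ends, so the increments of `θ` and of
saturation nearly agree; as `θ` is nondecreasing, a negative saturation increment must then be
small. -/
theorem abs_thetaHat_sub_sub_le (hQ : IsSaturation Q) (hI : IsInitial Q θ₀ q₀)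
    (hb : ThetaBounds Q (2 * M) T B L κ) (hL : 0 < L) (hn : 0 < n) (hδ : 0 < δt)
    (hw : ∀ i, |θ₀ i + q₀ i| ≤ 2 * M) (hsmall : n * δt * L ≤ κ) {c : ℝ} (hc : 0 < c)
    (hcn : c ≤ n * δt) {s t z : ℝ} (hs : 0 ≤ s) (hst : s ≤ t) (ht : t < T)
    (hz : z ∈ Ico (0 : ℝ) 1) :
    |thetaHat Q δt θ₀ q₀ t z - thetaHat Q δt θ₀ q₀ s z -
        max (Theta Q (thetaM θ₀ q₀ z) (flow Q δt θ₀ q₀ t z) t -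
          Theta Q (thetaM θ₀ q₀ z) (flow Q δt θ₀ q₀ s z) s) 0| ≤
      2 * (L * (2 / c + 1)) * (t - s + 2 * δt) := by
  obtain ⟨i, hi⟩ := exists_cell hn hz
  rw [thetaHat_eq hz.1 hi, thetaHat_eq hz.1 hi, thetaM_eq hi]
  have hinv := one_div_le_of_le_mul hc hn hcn
  have hdisc : ∀ t, 0 ≤ t → t < T →
      |Theta Q (θ₀ i + q₀ i) (flow Q δt θ₀ q₀ t z) t -
        Theta Q (θ₀ i + q₀ i) (height (flowPerm Q δt θ₀ q₀ ⌊t / δt⌋₊ i)) (⌊t / δt⌋₊ * δt)| ≤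
      L * (2 / c + 1) * δt := by
    intro t ht htT
    have hF := abs_height_sub_flow_le (Q := Q) (δt := δt) (θ₀ := θ₀) (q₀ := q₀) hz.1 hi t
    have h1 := floor_mul_le hδ ht
    have h2 := lt_floor_mul hδ t
    have hm1 := flow_mem_Icc (Q := Q) (δt := δt) (θ₀ := θ₀) (q₀ := q₀) hn hz t
    have hm2 := height_mem_Icc (flowPerm Q δt θ₀ q₀ ⌊t / δt⌋₊ i)
    have hm3 : t ∈ Icc 0 T := ⟨ht, htT.le⟩
    have hm4 := time_mem_Icc hδ (le_refl ⌊t / δt⌋₊) (h1.trans htT.le)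
    have h3 := hb.lipschitz (θ₀ i + q₀ i) _ _ _ _ (hw i) hm1 hm2 hm3 hm4
    have h4 := hb.lipschitz (θ₀ i + q₀ i) _ _ _ _ (hw i) hm2 hm1 hm4 hm3
    rw [abs_sub_comm (flow _ _ _ _ _ _), abs_of_nonneg (by linarith : 0 ≤ t - _ * δt)] at h4
    rw [abs_sub_comm (_ * δt), abs_of_nonneg (by linarith : 0 ≤ t - _ * δt)] at h3
    have h5 : L * (|height (flowPerm Q δt θ₀ q₀ ⌊t / δt⌋₊ i) - flow Q δt θ₀ q₀ t z| +
        (t - ⌊t / δt⌋₊ * δt)) ≤ L * (2 / c + 1) * δt := by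
      rw [mul_assoc]
      refine mul_le_mul_of_nonneg_left ?_ hL.le
      have h6 : (2 / c + 1) * δt = 2 * (δt / c) + δt := by ring
      have h7 : 0 ≤ δt / c := by positivity
      linarith
    rw [abs_le]
    constructor <;> linarith
  have ht0 := hs.trans hst
  have hkl := floor_div_mono hδ hst
  have hlT := (floor_mul_le hδ ht0).trans ht.le
  have hd1 := abs_le.1 (hdisc s hs (hst.trans_lt ht))
  have hd2 := abs_le.1 (hdisc t ht0 ht)
  have hmono := parcelTheta_mono (δt := δt) hQ hI i hkl
  have hdry1 := Theta_le_parcelTheta (δt := δt) hQ hI ⌊s / δt⌋₊ i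
  have hdry2 := Theta_le_parcelTheta (δt := δt) hQ hI ⌊t / δt⌋₊ i
  have hcases := parcelTheta_cases hQ hI hb hL hδ hw hsmall i hkl hlT
  have htime := time_mem_Icc hδ le_rfl hlT
  have htime' := time_mem_Icc hδ hkl hlT
  have hlip := hb.lipschitz (θ₀ i + q₀ i) (height (flowPerm Q δt θ₀ q₀ ⌊s / δt⌋₊ i))
    (height (flowPerm Q δt θ₀ q₀ ⌊s / δt⌋₊ i)) _ _ (hw i) (height_mem_Icc _) (height_mem_Icc _)
    htime' htime
  have hstep := floor_sub_mul_le hδ ht0 (s := s)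
  have hD : (0 : ℝ) ≤ (⌊t / δt⌋₊ : ℝ) - ⌊s / δt⌋₊ := sub_nonneg.2 (by exact_mod_cast hkl)
  rw [← sub_mul, abs_of_nonneg (mul_nonneg hD hδ.le), sub_self, abs_zero, zero_add] at hlip
  have hc1 : L ≤ L * (2 / c + 1) := by
    refine le_mul_of_one_le_right hL.le ?_
    have : 0 < 2 / c := by positivity
    linarith
  have hE : L * (2 / n + δt) * ((⌊t / δt⌋₊ : ℝ) - ⌊s / δt⌋₊) ≤
      L * (2 / c + 1) * (t - s + δt) := by
    have h1 : L * (2 / n + δt) ≤ L * (2 / c + 1) * δt := by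
      rw [mul_assoc]
      refine mul_le_mul_of_nonneg_left ?_ hL.le
      have h2 : (2 : ℝ) / n = 2 * (1 / n) := by ring
      have h3 : (2 / c + 1) * δt = 2 * (δt / c) + δt := by ring
      linarith
    refine (mul_le_mul_of_nonneg_right h1 hD).trans ?_
    rw [mul_assoc]
    exact mul_le_mul_of_nonneg_left hstep (by positivity)
  have hE' : L * δt * ((⌊t / δt⌋₊ : ℝ) - ⌊s / δt⌋₊) ≤ L * (2 / c + 1) * (t - s + δt) := by
    refine le_trans ?_ hE
    gcongr
    have : (0 : ℝ) ≤ 2 / n := by positivity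
    linarith
  have hK : 0 ≤ L * (2 / c + 1) * (t - s + δt) := by
    have : 0 ≤ t - s + δt := by linarith
    positivity
  have hgoal : 2 * (L * (2 / c + 1)) * (t - s + 2 * δt) =
      2 * (L * (2 / c + 1) * (t - s + δt)) + 2 * (L * (2 / c + 1) * δt) := by ring
  rw [hgoal]
  simp only at hmono
  rcases hcases with ⟨h1, h2⟩ | ⟨h1, h2⟩
  · have h3 := Theta_height_le (τ := ⌊t / δt⌋₊ * δt) hQ (le_refl (θ₀ i + q₀ i)) h2
    have h4 : L * (((⌊t / δt⌋₊ : ℝ) - ⌊s / δt⌋₊) * δt) =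
      L * δt * ((⌊t / δt⌋₊ : ℝ) - ⌊s / δt⌋₊) := by ring
    rw [h4] at hlip
    rw [h1, sub_self, zero_sub, abs_neg, abs_of_nonneg (le_max_right _ _)]
    refine max_le ?_ ?_ <;> linarith
  · rw [abs_le]
    rcases max_cases (Theta Q (θ₀ i + q₀ i) (flow Q δt θ₀ q₀ t z) t -
      Theta Q (θ₀ i + q₀ i) (flow Q δt θ₀ q₀ s z) s) 0 with ⟨h3, h4⟩ | ⟨h3, h4⟩ <;> rw [h3] <;>
    constructor <;> linarith

theorem eLpNorm_thetaHat_sub_eq (hn : 0 < n) (s t : ℝ) :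
    eLpNorm (fun z => thetaHat Q δt θ₀ q₀ t z - thetaHat Q δt θ₀ q₀ s z) 1
        (volume.restrict (Icc 0 1)) =
      ENNReal.ofReal (1 / n * ∑ i, |parcelTheta Q δt θ₀ q₀ ⌊t / δt⌋₊ i -
        parcelTheta Q δt θ₀ q₀ ⌊s / δt⌋₊ i|) :=
  eLpNorm_one_of_cells hn _ fun z hz i hi => by rw [thetaHat_eq hz.1 hi, thetaHat_eq hz.1 hi]

theorem eLpNorm_theta_sub_eq (hQ : IsSaturation Q) (hI : IsInitial Q θ₀ q₀) (hn : 0 < n)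
    (hδ : 0 < δt) {s t : ℝ} (hst : s ≤ t) :
    eLpNorm (fun z => theta Q δt θ₀ q₀ t z - theta Q δt θ₀ q₀ s z) 1
        (volume.restrict (Icc 0 1)) =
      eLpNorm (fun z => thetaHat Q δt θ₀ q₀ t z - thetaHat Q δt θ₀ q₀ s z) 1
        (volume.restrict (Icc 0 1)) := by
  rw [eLpNorm_thetaHat_sub_eq hn, ← sum_abs_solution_theta_sub hQ hI (floor_div_mono hδ hst)]
  exact eLpNorm_one_of_cells hn _ fun z hz i hi => by
    rw [theta, theta, cellFun_eq hi, cellFun_eq hi]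

theorem eLpNorm_thetaHat_sub_le (hQ : IsSaturation Q) (hI : IsInitial Q θ₀ q₀)
    (hb : ThetaBounds Q (2 * M) T B L κ) (hL : 0 < L) (hn : 0 < n) (hδ : 0 < δt)
    (hw : ∀ i, |θ₀ i + q₀ i| ≤ 2 * M) (hsmall : n * δt * L ≤ κ) {c : ℝ} (hc : 0 < c)
    (hcn : c ≤ n * δt) {s t : ℝ} (hs : 0 ≤ s) (hst : s ≤ t) (ht : t < T) :
    eLpNorm (fun z => thetaHat Q δt θ₀ q₀ t z - thetaHat Q δt θ₀ q₀ s z) 1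
        (volume.restrict (Icc 0 1)) ≤
      ENNReal.ofReal (L * (6 / c + 2) * (t - s + δt)) := by
  have hn' : (0 : ℝ) < n := Nat.cast_pos.2 hn
  have hkl := floor_div_mono hδ hst
  have ht0 := hs.trans hst
  rw [eLpNorm_thetaHat_sub_eq hn,
    Finset.sum_congr rfl fun i _ => abs_of_nonneg (sub_nonneg.2 (parcelTheta_mono hQ hI i hkl))]
  refine ENNReal.ofReal_le_ofReal ?_
  have h1 := sum_parcelTheta_sub_le hQ hI hb hL hδ hw hsmall hkl
    ((floor_mul_le hδ ht0).trans ht.le)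
  rw [one_div_mul_eq_div, div_le_iff₀' hn']
  refine h1.trans (mul_le_mul_of_nonneg_left ?_ hn'.le)
  have hD : (0 : ℝ) ≤ (⌊t / δt⌋₊ : ℝ) - ⌊s / δt⌋₊ := sub_nonneg.2 (by exact_mod_cast hkl)
  have h2 : L * (6 / n + 2 * δt) ≤ L * (6 / c + 2) * δt := by
    rw [mul_assoc]
    refine mul_le_mul_of_nonneg_left ?_ hL.le
    have h2 : (6 : ℝ) / n = 6 * (1 / n) := by ring
    have h3 : (6 / c + 2) * δt = 6 * (δt / c) + 2 * δt := by ring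
    linarith [one_div_le_of_le_mul hc hn hcn]
  refine (mul_le_mul_of_nonneg_right h2 hD).trans ?_
  rw [mul_assoc]
  exact mul_le_mul_of_nonneg_left (floor_sub_mul_le hδ ht0) (by positivity)

theorem eLpNorm_flow_sub_le (hQ : IsSaturation Q) (hI : IsInitial Q θ₀ q₀)
    (hb : ThetaBounds Q (2 * M) T B L κ) (hn : 0 < n) (hδ : 0 < δt)
    (hw : ∀ i, |θ₀ i + q₀ i| ≤ 2 * M) (hsmall : n * δt * L ≤ κ) {c : ℝ} (hc : 0 < c)
    (hcn : c ≤ n * δt) {s t : ℝ} (hs : 0 ≤ s) (hst : s ≤ t) (ht : t < T) :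
    eLpNorm (fun z => flow Q δt θ₀ q₀ t z - flow Q δt θ₀ q₀ s z) 1
        (volume.restrict (Icc 0 1)) ≤
      ENNReal.ofReal (4 / c * (t - s + δt)) := by
  have hn' : (0 : ℝ) < n := Nat.cast_pos.2 hn
  have hkl := floor_div_mono hδ hst
  have ht0 := hs.trans hst
  rw [eLpNorm_one_of_cells hn (fun i => height (flowPerm Q δt θ₀ q₀ ⌊t / δt⌋₊ i) -
    height (flowPerm Q δt θ₀ q₀ ⌊s / δt⌋₊ i)) fun z hz i hi => by
      rw [flow, flow, flowAt_eq hz.1 hi, flowAt_eq hz.1 hi, add_sub_add_left_eq_sub]]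
  refine ENNReal.ofReal_le_ofReal ?_
  have h1 := sum_abs_height_sub_le hQ hI hb hδ hw hsmall hkl ((floor_mul_le hδ ht0).trans ht.le)
  rw [one_div_mul_eq_div, div_le_iff₀' hn']
  refine h1.trans (mul_le_mul_of_nonneg_left ?_ hn'.le)
  have hD : (0 : ℝ) ≤ (⌊t / δt⌋₊ : ℝ) - ⌊s / δt⌋₊ := sub_nonneg.2 (by exact_mod_cast hkl)
  have h2 : (4 : ℝ) / n ≤ 4 / c * δt := by
    have h2 : (4 : ℝ) / n = 4 * (1 / n) := by ring
    have h3 : 4 / c * δt = 4 * (δt / c) := by ring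
    linarith [one_div_le_of_le_mul hc hn hcn]
  refine (mul_le_mul_of_nonneg_right h2 hD).trans ?_
  rw [mul_assoc]
  exact mul_le_mul_of_nonneg_left (floor_sub_mul_le hδ ht0) (by positivity)

/-- Weakens a linear rate to a square root rate on a bounded range. -/
theorem mul_le_mul_sqrt {a x X : ℝ} (ha : 0 ≤ a) (hx : 0 ≤ x) (hX : x ≤ X) :
    a * x ≤ a * √X * √x := by
  rw [mul_assoc]
  refine mul_le_mul_of_nonneg_left ?_ ha
  calc x = √x * √x := (Real.mul_self_sqrt hx).symm
    _ ≤ √X * √x := by gcongr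

end Estimates

end Rearrangement

theorem theorem3 (Q : ℝ → ℝ → ℝ → ℝ) (hQ : Rearrangement.IsSaturation Q)
    (T : ℝ) (hT : 0 < T) (M : ℝ) (hM : 0 ≤ M) :
    ∃ C₁ > (0 : ℝ), ∃ C₂ > (0 : ℝ), ∃ C₃ > (0 : ℝ), ∃ C₄' > (0 : ℝ),
      -- estimates without a smallness condition
      (∀ (n : ℕ) (δt : ℝ) (θ₀ q₀ : Fin n → ℝ), 0 < n → 0 < δt →
        Rearrangement.IsInitial Q θ₀ q₀ →
        Rearrangement.supNorm θ₀ + Rearrangement.supNorm q₀ ≤ ENNReal.ofReal M →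
        -- (i)
        (eLpNorm (fun p : ℝ × ℝ => Rearrangement.theta Q δt θ₀ q₀ p.1 p.2) ∞
              (volume.restrict (Ioo 0 T ×ˢ Ioo 0 1)) +
            eLpNorm (fun p : ℝ × ℝ => Rearrangement.moisture Q δt θ₀ q₀ p.1 p.2) ∞
              (volume.restrict (Ioo 0 T ×ˢ Ioo 0 1)) ≤ ENNReal.ofReal C₁) ∧
        -- (ii)
        (∀ ε : ℝ, C₂ / n < ε → ∀ t ∈ Ico 0 T, ∀ z ∈ Ico (0 : ℝ) 1,
          Rearrangement.Theta Q (Rearrangement.thetaM θ₀ q₀ z)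
              (Rearrangement.flow Q δt θ₀ q₀ t z) t + ε <
            Rearrangement.thetaHat Q δt θ₀ q₀ t z →
          ∀ t' : ℝ, t ≤ t' → t' < T → t' - t < ε / C₂ →
            Rearrangement.thetaHat Q δt θ₀ q₀ t' z = Rearrangement.thetaHat Q δt θ₀ q₀ t z ∧
            Rearrangement.flow Q δt θ₀ q₀ t' z ≤ Rearrangement.flow Q δt θ₀ q₀ t z) ∧
        -- (iii)
        (∀ z ∈ Icc (0 : ℝ) 1,
          eVariationOn (fun t => Rearrangement.flow Q δt θ₀ q₀ t z) (Ico 0 T) ≤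
            ENNReal.ofReal C₃)) ∧
      -- estimates for small `n δt`, with the ratio of `δt` and `1 / n` bounded below
      (∀ c > (0 : ℝ), ∃ C₄ > (0 : ℝ), ∃ C₅ > (0 : ℝ), ∃ C₆ > (0 : ℝ),
        ∀ (n : ℕ) (δt : ℝ) (θ₀ q₀ : Fin n → ℝ), 0 < n → 0 < δt →
        Rearrangement.IsInitial Q θ₀ q₀ →
        Rearrangement.supNorm θ₀ + Rearrangement.supNorm q₀ ≤ ENNReal.ofReal M →
        c ≤ n * δt → n * δt < 1 / C₄' →
        -- (iv)
        (∀ ε > (0 : ℝ), ∀ t : ℝ, Icc (t - ε) (t + ε) ⊆ Ico 0 T → ∀ z ∈ Ico (0 : ℝ) 1,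
          |Rearrangement.thetaHat Q δt θ₀ q₀ (t + ε) z -
              Rearrangement.thetaHat Q δt θ₀ q₀ (t - ε) z -
              max (Rearrangement.Theta Q (Rearrangement.thetaM θ₀ q₀ z)
                    (Rearrangement.flow Q δt θ₀ q₀ (t + ε) z) (t + ε) -
                  Rearrangement.Theta Q (Rearrangement.thetaM θ₀ q₀ z)
                    (Rearrangement.flow Q δt θ₀ q₀ (t - ε) z) (t - ε)) 0| ≤
            2 * C₄ * (ε + δt)) ∧
        -- (v)
        (∀ s ∈ Ico 0 T, ∀ t ∈ Ico 0 T, s < t →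
          eLpNorm (fun z => Rearrangement.theta Q δt θ₀ q₀ t z -
                Rearrangement.theta Q δt θ₀ q₀ s z) 1 (volume.restrict (Icc 0 1)) =
              eLpNorm (fun z => Rearrangement.thetaHat Q δt θ₀ q₀ t z -
                Rearrangement.thetaHat Q δt θ₀ q₀ s z) 1 (volume.restrict (Icc 0 1)) ∧
          eLpNorm (fun z => Rearrangement.thetaHat Q δt θ₀ q₀ t z -
                Rearrangement.thetaHat Q δt θ₀ q₀ s z) 1 (volume.restrict (Icc 0 1)) ≤
            ENNReal.ofReal (C₅ * √(t - s + δt))) ∧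
        -- (vi)
        (∀ s ∈ Ico 0 T, ∀ t ∈ Ico 0 T, s < t →
          eLpNorm (fun z => Rearrangement.flow Q δt θ₀ q₀ t z -
                Rearrangement.flow Q δt θ₀ q₀ s z) 1 (volume.restrict (Icc 0 1)) ≤
            ENNReal.ofReal (C₆ * √(t - s + δt)))) := by
  obtain ⟨B, hB, L, hL, κ, hκ, hb⟩ := Rearrangement.exists_thetaBounds hQ (2 * M) T
  have hdata : ∀ (n : ℕ) (θ₀ q₀ : Fin n → ℝ),
      Rearrangement.supNorm θ₀ + Rearrangement.supNorm q₀ ≤ ENNReal.ofReal M →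
      (∀ i, |θ₀ i| ≤ M) ∧ ∀ i, |θ₀ i + q₀ i| ≤ 2 * M := by
    intro n θ₀ q₀ h
    have h1 := Rearrangement.abs_le_of_supNorm_le hM (le_self_add.trans h)
    have h2 := Rearrangement.abs_le_of_supNorm_le hM (le_add_self.trans h)
    refine ⟨h1, fun i => (abs_add_le _ _).trans ?_⟩
    linarith [h1 i, h2 i]
  refine ⟨(M + B) + (3 * M + B), by positivity, 2 * L, by positivity,
    1 + 2 / κ * (2 * (M + B)), by positivity, L / κ, by positivity, ?_, ?_⟩
  · intro n δt θ₀ q₀ hn hδ hI hnorm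
    obtain ⟨hθ, hw⟩ := hdata n θ₀ q₀ hnorm
    exact ⟨Rearrangement.eLpNorm_theta_add_moisture_le hQ hI hb hB hM hn hδ hθ hw,
      fun ε hε t ht z hz h t' htt htT hclose =>
        Rearrangement.thetaHat_eq_of_surplus hQ hI hb hL hn hδ hw hε ht hz h htt htT hclose,
      fun z hz => Rearrangement.eVariationOn_flow_le hQ hI hb hB hκ hM hn hδ hθ hw hz⟩
  · intro c hc
    -- Smallness gives `δt ≤ n δt < κ / L`, so `T + κ / L` bounds `t - s + δt` under the roots. In
    -- the first constant, the interval from `t - ε` to `t + ε` has length `2 ε`, which accounts for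
    -- the factor `2`.
    refine ⟨2 * (L * (2 / c + 1)), by positivity, L * (6 / c + 2) * √(T + κ / L), by positivity,
      4 / c * √(T + κ / L), by positivity, ?_⟩
    intro n δt θ₀ q₀ hn hδ hI hnorm hcn hsmall
    obtain ⟨hθ, hw⟩ := hdata n θ₀ q₀ hnorm
    rw [one_div_div] at hsmall
    have hsmall' : n * δt * L ≤ κ := ((lt_div_iff₀ hL).1 hsmall).le
    have hδκ : δt ≤ κ / L := by
      have : (1 : ℝ) ≤ n := by exact_mod_cast hn
      nlinarith
    refine ⟨fun ε hε t hsub z hz => ?_, fun s hs t ht hst => ?_, fun s hs t ht hst => ?_⟩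
    · have h1 := hsub (left_mem_Icc.2 (by linarith))
      have h2 := hsub (right_mem_Icc.2 (by linarith))
      refine (Rearrangement.abs_thetaHat_sub_sub_le hQ hI hb hL hn hδ hw hsmall' hc hcn h1.1 (by linarith)
        h2.2 hz).trans (le_of_eq ?_)
      ring
    · refine ⟨Rearrangement.eLpNorm_theta_sub_eq hQ hI hn hδ hst.le,
        (Rearrangement.eLpNorm_thetaHat_sub_le hQ hI hb hL hn hδ hw hsmall' hc hcn hs.1 hst.le ht.2).trans
          (ENNReal.ofReal_le_ofReal (Rearrangement.mul_le_mul_sqrt (by positivity) ?_ ?_))⟩ <;>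
      linarith [hs.1, ht.2]
    · refine (Rearrangement.eLpNorm_flow_sub_le hQ hI hb hn hδ hw hsmall' hc hcn hs.1 hst.le ht.2).trans
          (ENNReal.ofReal_le_ofReal (Rearrangement.mul_le_mul_sqrt (by positivity) ?_ ?_)) <;>
      linarith [hs.1, ht.2]
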